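/- For integers $N\ge 0$, $r\ge 1$ let $S_{N,r}$ be the set of tuples $(n_1,\dots,n_r)$ of odd integers $n_i\ge 3$ with $n_1+\cdots+n_r=N$, let $\mathsf{Vect}_{N,r}$ be the space of rational row vectors indexed by $S_{N,r}$, let $\mathbf V_{N,r}\subset\mathbb Q[x_1,\dots,x_r]$ be the span of the monomials $x_1^{n_1-1}\cdots x_r^{n_r-1}$ with $(n_1,\dots,n_r)\in S_{N,r}$, and let $\pi\colon\mathbf V_{N,r}\to\mathsf{Vect}_{N,r}$ be the isomorphism taking a polynomial to its coefficient vector. For $r\ge2$ let $$\mathbf W_{N,r}=\{P\in\mathbf V_{N,r}: P(x_1,\dots,x_r)=P(x_2-x_1,x_2,x_3,\dots,x_r)-P(x_2-x_1,x_1,x_3,\dots,x_r)\}.$$ For a homogeneous $f\in\mathbb Q[x_1]$ and $g\in\mathbb Q[x_1,\dots,x_{r-1}]$ put $$(f\circ g)(x_1,\dots,x_r)=f(x_1)g(x_2,\dots,x_r)+\sum_{i=1}^{r-1}\Bigl(f(x_{i+1}-x_i)\,g(x_1,\dots,\hat x_{i+1},\dots,x_r)-(-1)^{\deg f}f(x_i-x_{i+1})\,g(x_1,\dots,\hat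 x_i,\dots,x_r)\Bigr),$$ where a hat means that the variable is omitted, and let $e(m_1,\dots,m_r;n_1,\dots,n_r)$ be the coefficient of $x_1^{n_1-1}\cdots x_r^{n_r-1}$ in $x_1^{m_1-1}\circ(x_1^{m_2-1}\cdots x_{r-1}^{m_r-1})$. Define matrices with rows and columns indexed by $m,n\in S_{N,r}$: $E_{N,r}$ has entries $e(m;n)$; for $2\le j\le r$, $E^{(j)}_{N,r}$ has entries $\delta_{(m_1,\dots,m_{r-j}),(n_1,\dots,n_{r-j})}\,e(m_{r-j+1},\dots,m_r;n_{r-j+1},\dots,n_r)$; and $$C_{N,r}=E_{N,r}^{(2)}E_{N,r}^{(3)}\cdots E_{N,r}^{(r-1)}E_{N,r}$$ (so $C_{N,1}=E_{N,1}$ and $C_{N,2}=E_{N,2}$). For $2\le j\le r$ let $\phi_j\colon\mathbf V_{N,r}\to\mathbf V_{N,r}$ take $Q$ to the sum of those monomials, with all exponents even and at least $2$, of the polynomial $$Q+\sum_{i=r-j+1}^{r-1}\Bigl(Q(x_1,\dots,x_{r-j},x_{i+1}-x_i,x_{r-j+1},\dots,\hat x_{i+1},\dots,x_r)-Q(x_1,\dots,x_{r-j},x_{i+1}-x_i,x_{r-j+1},\dots,\hat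 x_i,\dots,x_r)\Bigr).$$ Assume the following two conjectural statements. 1. (Injectivity of Tasaka's map.) For all $r\ge2$ and $N>0$ the linear map $\mathbf W_{N,r}\to\ker{}^tE_{N,r}$, $P\mapsto\pi(P)(E_{N,r}-\mathrm{id})$, is injective. 2. For all $r\ge3$ and $N>0$, $$(\phi_{r-1}\circ\cdots\circ\phi_2)(\mathbf W_{N,r})=\ker\phi_r\cap\operatorname{Im}(\phi_{r-1}\circ\cdots\circ\phi_2).$$ Then, in $\mathbb Q[[x]][[y]]$, $$1+\sum_{N,r>0}\operatorname{rank}C_{N,r}\,x^Ny^r=\frac{1}{1-\mathbb O(x)y+\mathbb S(x)y^2},\qquad \mathbb O(x)=\frac{x^3}{1-x^2},\quad \mathbb S(x)=\frac{x^{12}}{(1-x^4)(1-x^6)}.$$ -/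

import Mathlib

open scoped Polynomial

/-- The set `S_{N,r}` of totally odd indices: tuples `(n_1, …, n_r)` of odd integers `≥ 3`
with sum `N`. The entry `n_k` is the value at the element `k - 1` of `Fin r`. -/
def oddIndices (N r : ℕ) : Finset (Fin r → ℕ) :=
  (Finset.Nat.antidiagonalTuple r N).filter fun n => ∀ i, 3 ≤ n i ∧ Odd (n i)

/-- `S_{N,r}` as a type, used to index vectors and matrices. -/
abbrev OddIdx (N r : ℕ) : Type := {n : Fin r → ℕ // n ∈ oddIndices N r}

/-- The space `Vect_{N,r}` of row vectors indexed by `S_{N,r}`. -/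
abbrev OddVect (N r : ℕ) : Type := OddIdx N r → ℚ

/-- The `k`-th entry `m_k` (numbered from `1`) of an `r`-tuple; it is used for `1 ≤ k ≤ r`. -/
def tupleEntry {r : ℕ} (m : Fin r → ℕ) (k : ℕ) : ℕ :=
  if h : k - 1 < r then m ⟨k - 1, h⟩ else 0

/-- The exponent vector of the monomial `x_1^{n_1 - 1} ⋯ x_r^{n_r - 1}`. -/
noncomputable def shiftedExponent {r : ℕ} (n : Fin r → ℕ) : Fin r →₀ ℕ :=
  Finsupp.equivFunOnFinite.symm fun i => n i - 1

/-- The variable `x_k` (numbered from `1`) of `ℚ[x_1, …, x_r]`; it is used for `1 ≤ k ≤ r`. -/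
noncomputable def polyVar (r k : ℕ) : MvPolynomial (Fin r) ℚ :=
  if h : k - 1 < r then MvPolynomial.X ⟨k - 1, h⟩ else 0

/-- The `k`-th entry (numbered from `1`) of the sequence `x_1, …, x_r` with `x_p` omitted. -/
noncomputable def omitVar (r p k : ℕ) : MvPolynomial (Fin r) ℚ :=
  if k < p then polyVar r k else polyVar r (k + 1)

/-- The Ihara action `f ∘ g ∈ ℚ[x_1, …, x_r]` of `f` (one variable, homogeneous) on
`g` (`r - 1` variables):
`f(x_1) g(x_2, …, x_r) + ∑_{i=1}^{r-1} ( f(x_{i+1} - x_i) g(x_1, …, x̂_{i+1}, …, x_r)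
  - (-1)^{deg f} f(x_i - x_{i+1}) g(x_1, …, x̂_i, …, x_r) )`. -/
noncomputable def iharaAction (r : ℕ) (f : ℚ[X]) (g : MvPolynomial (Fin (r - 1)) ℚ) :
    MvPolynomial (Fin r) ℚ :=
  Polynomial.aeval (polyVar r 1) f *
      MvPolynomial.aeval (fun k : Fin (r - 1) => polyVar r (k.val + 2)) g +
    ∑ i ∈ Finset.Ico 1 r,
      (Polynomial.aeval (polyVar r (i + 1) - polyVar r i) f *
          MvPolynomial.aeval (fun k : Fin (r - 1) => omitVar r (i + 1) (k.val + 1)) g -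
        (-1) ^ f.natDegree * Polynomial.aeval (polyVar r i - polyVar r (i + 1)) f *
          MvPolynomial.aeval (fun k : Fin (r - 1) => omitVar r i (k.val + 1)) g)

/-- The integer `e(m_1, …, m_r; n_1, …, n_r)` (as a rational number): the coefficient of
`x_1^{n_1-1} ⋯ x_r^{n_r-1}` in `x_1^{m_1-1} ∘ (x_1^{m_2-1} ⋯ x_{r-1}^{m_r-1})`.
The tuples are given as sequences of which only the entries `1, …, r` matter. -/
noncomputable def iharaCoeff (r : ℕ) (m n : ℕ → ℕ) : ℚ :=
  MvPolynomial.coeff (shiftedExponent fun i : Fin r => n (i.val + 1))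
    (iharaAction r (Polynomial.X ^ (m 1 - 1))
      (∏ k : Fin (r - 1), MvPolynomial.X k ^ (m (k.val + 2) - 1)))

/-- The matrix `E_{N,r}` (for `r ≥ 1`). -/
noncomputable def matE (N r : ℕ) : Matrix (OddIdx N r) (OddIdx N r) ℚ :=
  Matrix.of fun m n => iharaCoeff r (tupleEntry m.1) (tupleEntry n.1)

/-- The matrix `E_{N,r}^{(j)}` (for `2 ≤ j ≤ r`), with entries
`δ(m_1, …, m_{r-j}; n_1, …, n_{r-j}) e(m_{r-j+1}, …, m_r; n_{r-j+1}, …, n_r)`. -/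
noncomputable def matEj (N r j : ℕ) : Matrix (OddIdx N r) (OddIdx N r) ℚ :=
  Matrix.of fun m n =>
    if ∀ i : Fin r, i.val < r - j → m.1 i = n.1 i then
      iharaCoeff j (fun k => tupleEntry m.1 (r - j + k)) (fun k => tupleEntry n.1 (r - j + k))
    else 0

/-- The matrix `C_{N,r} = E_{N,r}^{(2)} E_{N,r}^{(3)} ⋯ E_{N,r}^{(r-1)} E_{N,r}` (for `r ≥ 1`). -/
noncomputable def matC (N r : ℕ) : Matrix (OddIdx N r) (OddIdx N r) ℚ :=
  ((List.range' 2 (r - 2)).map (matEj N r)).prod * matE N r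

/-- The space `V_{N,r}` of restricted totally even homogeneous polynomials of degree `N - r`. -/
noncomputable def evenPolys (N r : ℕ) : Submodule ℚ (MvPolynomial (Fin r) ℚ) :=
  Submodule.span ℚ
    (Set.range fun m : OddIdx N r => MvPolynomial.monomial (shiftedExponent m.1) (1 : ℚ))

/-- The isomorphism `π : V_{N,r} → Vect_{N,r}` taking a polynomial to its coefficient vector. -/
noncomputable def coeffVector (N r : ℕ) : evenPolys N r →ₗ[ℚ] OddVect N r where
  toFun P := fun n => MvPolynomial.coeff (shiftedExponent n.1) P.1
  map_add' P Q := by ext n; simp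
  map_smul' c P := by ext n; simp

/-- The subspace `W_{N,r}` (for `r ≥ 2`) of those `P ∈ V_{N,r}` with
`P(x_1, …, x_r) = P(x_2 - x_1, x_2, x_3, …, x_r) - P(x_2 - x_1, x_1, x_3, …, x_r)`. -/
noncomputable def periodPolys (N r : ℕ) : Submodule ℚ (evenPolys N r) where
  carrier := {P | P.1 =
    MvPolynomial.aeval (fun k : Fin r =>
      if k.val = 0 then polyVar r 2 - polyVar r 1
      else if k.val = 1 then polyVar r 2 else polyVar r (k.val + 1)) P.1 -
    MvPolynomial.aeval (fun k : Fin r =>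
      if k.val = 0 then polyVar r 2 - polyVar r 1
      else if k.val = 1 then polyVar r 1 else polyVar r (k.val + 1)) P.1}
  add_mem' {P Q} hP hQ := by
    simp only [Set.mem_ofPred_eq, Submodule.coe_add, map_add] at *
    nth_rewrite 1 [hP, hQ]
    abel
  zero_mem' := by simp
  smul_mem' c P hP := by
    simp only [Set.mem_ofPred_eq, Submodule.coe_smul, map_smul] at *
    nth_rewrite 1 [hP]
    rw [smul_sub]

/-- The map `W_{N,r} → Vect_{N,r}`, `P ↦ π(P) F_{N,r}` with `F_{N,r} = E_{N,r} - id`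
(its image lies in the left kernel of `E_{N,r}`; whether it is injective does not depend on the
codomain). -/
noncomputable def tasakaMap (N r : ℕ) : periodPolys N r →ₗ[ℚ] OddVect N r :=
  (matE N r - 1).vecMulLinear ∘ₗ coeffVector N r ∘ₗ (periodPolys N r).subtype

/-- The restricted totally even part of a polynomial: the sum of those of its monomials in which
every exponent is even and at least `2`. -/
noncomputable def totallyEvenPart (r : ℕ) :
    MvPolynomial (Fin r) ℚ →ₗ[ℚ] MvPolynomial (Fin r) ℚ where
  toFun Q := ∑ d ∈ Q.support with ∀ i, Even (d i) ∧ 2 ≤ d i,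
    MvPolynomial.monomial d (MvPolynomial.coeff d Q)
  map_add' P Q := by
    classical
    ext d
    simp only [MvPolynomial.coeff_add, MvPolynomial.coeff_sum, MvPolynomial.coeff_monomial,
      Finset.sum_ite_eq', Finset.mem_filter, MvPolynomial.mem_support_iff]
    by_cases h : ∀ i, Even (d i) ∧ 2 ≤ d i <;> simp [h]
    split_ifs <;> simp_all
  map_smul' c P := by
    classical
    ext d
    simp only [MvPolynomial.coeff_smul, MvPolynomial.coeff_sum, MvPolynomial.coeff_monomial,
      Finset.sum_ite_eq', Finset.mem_filter, MvPolynomial.mem_support_iff, RingHom.id_apply]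
    by_cases h : ∀ i, Even (d i) ∧ 2 ≤ d i <;> simp [h]
    split_ifs <;> simp_all

/-- The `k`-th entry (numbered from `1`) of the sequence
`x_1, …, x_{r-j}, x_{i+1} - x_i, x_{r-j+1}, …, x̂_p, …, x_r`, where `r - j < p`. -/
noncomputable def phiArg (r j i p k : ℕ) : MvPolynomial (Fin r) ℚ :=
  if k ≤ r - j then polyVar r k
  else if k = r - j + 1 then polyVar r (i + 1) - polyVar r i
  else omitVar r p (k - 1)

/-- The polynomial `Q + ∑_{i=r-j+1}^{r-1} (
  Q(x_1, …, x_{r-j}, x_{i+1} - x_i, x_{r-j+1}, …, x̂_{i+1}, …, x_r)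
  - Q(x_1, …, x_{r-j}, x_{i+1} - x_i, x_{r-j+1}, …, x̂_i, …, x_r))`. -/
noncomputable def phiPoly (r j : ℕ) : MvPolynomial (Fin r) ℚ →ₗ[ℚ] MvPolynomial (Fin r) ℚ :=
  LinearMap.id + ∑ i ∈ Finset.Ico (r - j + 1) r,
    ((MvPolynomial.aeval fun k : Fin r => phiArg r j i (i + 1) (k.val + 1)).toLinearMap -
      (MvPolynomial.aeval fun k : Fin r => phiArg r j i i (k.val + 1)).toLinearMap)

lemma polyVar_isHomogeneous (r k : ℕ) : (polyVar r k).IsHomogeneous 1 := by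
  unfold polyVar
  split_ifs
  · exact MvPolynomial.isHomogeneous_X _ _
  · exact MvPolynomial.isHomogeneous_zero _ _ _

lemma phiArg_isHomogeneous (r j i p k : ℕ) : (phiArg r j i p k).IsHomogeneous 1 := by
  unfold phiArg omitVar
  split_ifs
  · exact polyVar_isHomogeneous _ _
  · exact (polyVar_isHomogeneous _ _).sub (polyVar_isHomogeneous _ _)
  · exact polyVar_isHomogeneous _ _
  · exact polyVar_isHomogeneous _ _

lemma phiPoly_isHomogeneous (r j D : ℕ) {Q : MvPolynomial (Fin r) ℚ} (hQ : Q.IsHomogeneous D) :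
    (phiPoly r j Q).IsHomogeneous D := by
  have key : ∀ i p, (MvPolynomial.aeval (fun k : Fin r => phiArg r j i p (k.val + 1))
      Q).IsHomogeneous D := fun i p => by
    simpa using hQ.aeval (n := 1) _ fun k => phiArg_isHomogeneous r j i p (k.val + 1)
  simp only [phiPoly, LinearMap.add_apply, LinearMap.id_apply, LinearMap.sum_apply,
    LinearMap.sub_apply, AlgHom.toLinearMap_apply]
  exact hQ.add (MvPolynomial.IsHomogeneous.sum _ _ _ fun i _ => (key i _).sub (key i _))

lemma totallyEvenPart_mem (N r D : ℕ) (hD : D + r = N) {Q : MvPolynomial (Fin r) ℚ}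
    (hQ : Q.IsHomogeneous D) : totallyEvenPart r Q ∈ evenPolys N r := by
  refine Submodule.sum_mem _ fun d hd => ?_
  rw [Finset.mem_filter, MvPolynomial.mem_support_iff] at hd
  have hdeg : ∑ i, d i = D := by
    have := hQ hd.1
    rwa [show Finsupp.weight (1 : Fin r → ℕ) d = d.degree by
      rw [Finsupp.degree_eq_weight_one]; rfl, Finsupp.degree_eq_sum] at this
  have hm : (fun i => d i + 1) ∈ oddIndices N r := by
    simp only [oddIndices, Finset.mem_filter, Finset.Nat.mem_antidiagonalTuple]
    refine ⟨by simp [Finset.sum_add_distrib, hdeg, hD], fun i => ?_⟩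
    exact ⟨by have := (hd.2 i).2; omega, (hd.2 i).1.add_one⟩
  have he : shiftedExponent (fun i => d i + 1) = d := by
    ext i
    simp [shiftedExponent]
  have hc : MvPolynomial.monomial d (MvPolynomial.coeff d Q) =
      MvPolynomial.coeff d Q • MvPolynomial.monomial d (1 : ℚ) := by
    rw [MvPolynomial.smul_monomial, smul_eq_mul, mul_one]
  rw [hc]
  refine Submodule.smul_mem _ _ (Submodule.subset_span ⟨⟨_, hm⟩, ?_⟩)
  simp only [he]

lemma phi_mem (N r j : ℕ) {Q : MvPolynomial (Fin r) ℚ} (hQ : Q ∈ evenPolys N r) :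
    (totallyEvenPart r ∘ₗ phiPoly r j) Q ∈ evenPolys N r := by
  refine (Submodule.span_le (p := (evenPolys N r).comap (totallyEvenPart r ∘ₗ phiPoly r j))).2
    ?_ hQ
  rintro _ ⟨m, rfl⟩
  have hm := m.2
  simp only [oddIndices, Finset.mem_filter, Finset.Nat.mem_antidiagonalTuple] at hm
  refine totallyEvenPart_mem N r (∑ i, (m.1 i - 1)) ?_ (phiPoly_isHomogeneous r j _ ?_)
  · refine Eq.trans ?_ hm.1
    have : ∀ i, m.1 i = (m.1 i - 1) + 1 := fun i => by have := (hm.2 i).1; omega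
    conv_rhs => rw [Finset.sum_congr rfl fun i _ => this i]
    simp [Finset.sum_add_distrib]
  · apply MvPolynomial.isHomogeneous_monomial
    rw [Finsupp.degree_eq_sum]
    simp [shiftedExponent]

/-- The endomorphism `φ_j` of `V_{N,r}` (for `1 ≤ j ≤ r`). -/
noncomputable def phi (N r j : ℕ) : evenPolys N r →ₗ[ℚ] evenPolys N r :=
  (totallyEvenPart r ∘ₗ phiPoly r j).restrict fun _ hQ => phi_mem N r j hQ

/-- The composition `φ_j ∘ φ_{j-1} ∘ ⋯ ∘ φ_2` on `V_{N,r}` (the identity if `j < 2`). -/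
noncomputable def phiComp (N r : ℕ) : ℕ → (evenPolys N r →ₗ[ℚ] evenPolys N r)
  | 0 => LinearMap.id
  | 1 => LinearMap.id
  | j + 2 => phi N r (j + 2) ∘ₗ phiComp N r (j + 1)

/-- For all `r ≥ 2` and all `N > 0`, the map `W_{N,r} → ker ᵗE_{N,r}`, `P ↦ π(P) F_{N,r}`,
is injective. -/
def TasakaInjectivity : Prop :=
  ∀ r N : ℕ, 2 ≤ r → 0 < N → Function.Injective (tasakaMap N r)

/-- For all `r ≥ 3` and all `N > 0`, the image of `W_{N,r}` under `φ_{r-1} ∘ ⋯ ∘ φ_2` equals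
`ker φ_r ∩ Im (φ_{r-1} ∘ ⋯ ∘ φ_2)`. -/
def ImageKernelConjecture : Prop :=
  ∀ r N : ℕ, 3 ≤ r → 0 < N →
    (periodPolys N r).map (phiComp N r (r - 1)) =
      LinearMap.ker (phi N r r) ⊓ LinearMap.range (phiComp N r (r - 1))

/-- `𝕆(x) = x^3 / (1 - x^2)`. -/
noncomputable def seriesO : PowerSeries ℚ :=
  PowerSeries.X ^ 3 * (1 - PowerSeries.X ^ 2)⁻¹

/-- `𝕊(x) = x^12 / ((1 - x^4) (1 - x^6))`. -/
noncomputable def seriesS : PowerSeries ℚ :=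
  PowerSeries.X ^ 12 * ((1 - PowerSeries.X ^ 4) * (1 - PowerSeries.X ^ 6))⁻¹

/-- `1 + ∑_{N,r>0} rank C_{N,r} x^N y^r` in `ℚ⟦x⟧⟦y⟧`. -/
noncomputable def rankSeries : PowerSeries (PowerSeries ℚ) :=
  1 + PowerSeries.mk fun r => PowerSeries.mk fun N =>
    if 0 < N ∧ 0 < r then ((matC N r).rank : ℚ) else 0

/-!
On coefficient vectors, multiplication by `E_{N,r}^{(j)}` is `φ_j`, so `rank C_{N,r}` is the rank
of `φ_r ∘ ⋯ ∘ φ_2`. Rank–nullity for `φ_r` on the image of `φ_{r-1} ∘ ⋯ ∘ φ_2` turns this into a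
linear recursion. The maps `φ_2, …, φ_{r-1}` leave `x_1` alone, so that image has dimension
`∑_{a+b=N} |S_{a,1}| rank C_{b,r-1}`. By the second conjecture the kernel of `φ_r` on it is the
image of `W_{N,r}`. On `W_{N,r}` the map `φ_{r-1}` is, up to sign, Tasaka's map, hence injective,
and `φ_2, …, φ_{r-2}` leave `x_1` and `x_2` alone, so the kernel has dimension
`∑_{a+b=N} dim W_{a,2} rank C_{b,r-2}`.

It remains to see that `𝕊` is the generating series of `dim W_{N,2}`. For even `N`, `W_{N,2}` is the
kernel, on antisymmetric polynomials in `V_{N,2}`, of the sum over the iterates of the order three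
substitution `p(x, y) ↦ p(x - y, x)`. Apolarity shows that this sum maps onto the forms of degree
`N - 2` alternating under the action of the symmetric group on three letters. Those have a basis
of products `A B^i D^j`, where `A = x y (x - y) (x + y) (x - 2 y) (2 x - y)`,
`B = x² - x y + y²` and `D = (x y (x - y))²`.
-/

section LinearAlgebra

variable {K : Type*} [Field K]

lemma finrank_submodulePi {ι : Type*} [Fintype ι] {V : ι → Type*} [∀ i, AddCommGroup (V i)]
    [∀ i, Module K (V i)] [∀ i, FiniteDimensional K (V i)] (p : ∀ i, Submodule K (V i)) :
    Module.finrank K (Submodule.pi Set.univ p) = ∑ i, Module.finrank K (p i) := by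
  have hrange : LinearMap.range (LinearMap.piMap fun i => (p i).subtype) =
      Submodule.pi Set.univ p := by
    apply SetLike.coe_injective
    simp [LinearMap.coe_range, LinearMap.coe_piMap, Set.range_piMap, Submodule.coe_pi]
  have hinj : Function.Injective (LinearMap.piMap fun i => (p i).subtype) :=
    Function.Injective.piMap fun i => (p i).subtype_injective
  rw [← hrange, LinearMap.finrank_range_of_inj hinj, Module.finrank_pi_fintype]

lemma finrank_map_piMap_submodulePi {ι : Type*} [Fintype ι] {V V' : ι → Type*}
    [∀ i, AddCommGroup (V i)] [∀ i, Module K (V i)] [∀ i, AddCommGroup (V' i)]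
    [∀ i, Module K (V' i)] [∀ i, FiniteDimensional K (V' i)] (p : ∀ i, Submodule K (V i))
    (f : ∀ i, V i →ₗ[K] V' i) :
    Module.finrank K ((Submodule.pi Set.univ p).map (LinearMap.piMap f)) =
      ∑ i, Module.finrank K ((p i).map (f i)) := by
  have hmap : (Submodule.pi Set.univ p).map (LinearMap.piMap f) =
      Submodule.pi Set.univ fun i => (p i).map (f i) := by
    apply SetLike.coe_injective
    simp only [Submodule.map_coe, Submodule.coe_pi, LinearMap.coe_piMap, Set.piMap_image_univ_pi]
  rw [hmap, finrank_submodulePi]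

lemma rank_eq_finrank_range_vecMulLinear {I J : Type*} [Fintype I] [Fintype J] (M : Matrix I J K) :
    M.rank = Module.finrank K (LinearMap.range M.vecMulLinear) := by
  rw [← Matrix.rank_transpose, Matrix.rank, Matrix.mulVecLin_transpose]

lemma finrank_range_mulRightLinearMap {I J J' : Type*} [Fintype I] [Fintype J] [Fintype J']
    (M : Matrix J J' K) :
    Module.finrank K (LinearMap.range (mulRightLinearMap I K M)) =
      Fintype.card I * M.rank := by
  have hrows : Module.finrank K (LinearMap.range (mulRightLinearMap I K M)) =
      Module.finrank K (LinearMap.range (LinearMap.piMap fun _ : I => M.vecMulLinear)) := rfl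
  have htop : (⊤ : Submodule K (I → J → K)) = Submodule.pi Set.univ fun _ => ⊤ := by
    ext
    simp
  rw [hrows, LinearMap.range_eq_map, htop, finrank_map_piMap_submodulePi,
    rank_eq_finrank_range_vecMulLinear, LinearMap.range_eq_map]
  simp

/-- The matrices all of whose columns lie in `W`, that is `W ⊗ K^J` as a space of matrices. -/
def columnsIn {I : Type*} (W : Submodule K (I → K)) (J : Type*) : Submodule K (Matrix I J K) where
  carrier := {X | ∀ j, X.col j ∈ W}
  add_mem' hX hY j := W.add_mem (hX j) (hY j)
  zero_mem' _ := W.zero_mem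
  smul_mem' c _ hX j := W.smul_mem c (hX j)

lemma mem_columnsIn {I J : Type*} {W : Submodule K (I → K)} {X : Matrix I J K} :
    X ∈ columnsIn W J ↔ ∀ j, X.col j ∈ W := Iff.rfl

lemma map_mulRightLinearMap_columnsIn_le {I J J' : Type*} [Fintype J] (W : Submodule K (I → K))
    (M : Matrix J J' K) : (columnsIn W J).map (mulRightLinearMap I K M) ≤ columnsIn W J' := by
  rintro _ ⟨X, hX, rfl⟩
  refine mem_columnsIn.2 fun j => ?_
  have hcol : (X * M).col j = ∑ s, M s j • X.col s := by
    ext i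
    simp [Matrix.mul_apply, mul_comm]
  rw [mulRightLinearMap_apply, hcol]
  exact Submodule.sum_mem _ fun s _ => Submodule.smul_mem _ _ (mem_columnsIn.1 hX s)

lemma exists_injective_mulVec_and_range_eq {I : Type*} [Finite I] (W : Submodule K (I → K)) :
    ∃ B : Matrix I (Fin (Module.finrank K W)) K,
      Function.Injective B.mulVec ∧ LinearMap.range B.mulVecLin = W := by
  let f := W.subtype ∘ₗ (Module.finBasis K W).equivFun.symm.toLinearMap
  have hf : (LinearMap.toMatrix' f).mulVecLin = f := Matrix.toLin'_toMatrix' f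
  refine ⟨LinearMap.toMatrix' f, ?_, ?_⟩
  · rw [← Matrix.coe_mulVecLin, hf]
    exact W.subtype_injective.comp (LinearEquiv.injective _)
  · rw [hf, LinearMap.range_comp, LinearEquiv.range, Submodule.map_top, Submodule.range_subtype]

lemma columnsIn_range_mulVecLin {I D J : Type*} [Fintype D] (B : Matrix I D K) :
    columnsIn (LinearMap.range B.mulVecLin) J = LinearMap.range (mulLeftLinearMap J K B) := by
  ext X
  rw [mem_columnsIn]
  constructor
  · intro hX
    choose Y hY using hX
    exact ⟨(Matrix.of Y).transpose, Matrix.ext_col hY⟩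
  · rintro ⟨Y, rfl⟩ j
    exact ⟨Y.col j, rfl⟩

lemma finrank_map_mulRightLinearMap_columnsIn {I J J' : Type*} [Finite I] [Fintype J]
    [Fintype J'] (W : Submodule K (I → K)) (M : Matrix J J' K) :
    Module.finrank K ((columnsIn W J).map (mulRightLinearMap I K M)) =
      Module.finrank K W * M.rank := by
  obtain ⟨B, hB, hW⟩ := exists_injective_mulVec_and_range_eq W
  have hmap : (columnsIn W J).map (mulRightLinearMap I K M) =
      (LinearMap.range (mulRightLinearMap _ K M)).map (mulLeftLinearMap J' K B) := by
    conv_lhs => rw [← hW]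
    rw [columnsIn_range_mulVecLin, ← LinearMap.range_comp, ← LinearMap.range_comp,
      commute_mulLeftLinearMap_mulRightLinearMap]
  have hinj : Function.Injective (mulLeftLinearMap J' K B) := fun X Y h =>
    Matrix.ext_col fun j => hB (congrArg (Matrix.col · j) h)
  have hfinrank := (Submodule.equivMapOfInjective (mulLeftLinearMap J' K B) hinj
    (LinearMap.range (mulRightLinearMap _ K M))).finrank_eq
  rw [hmap, ← hfinrank, finrank_range_mulRightLinearMap, Fintype.card_fin]

lemma finrank_map_add_finrank_ker_inf {V W : Type*} [AddCommGroup V] [Module K V]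
    [AddCommGroup W] [Module K W] (f : V →ₗ[K] W) (U : Submodule K V) [FiniteDimensional K U] :
    Module.finrank K (U.map f) + Module.finrank K (LinearMap.ker f ⊓ U : Submodule K V) =
      Module.finrank K U := by
  rw [← LinearMap.finrank_range_add_finrank_ker (f.domRestrict U), LinearMap.range_domRestrict,
    LinearMap.ker_domRestrict, inf_comm, ← Submodule.map_comap_subtype,
    (Submodule.equivMapOfInjective _ U.subtype_injective _).finrank_eq]

end LinearAlgebra

section ExternalProduct

open MvPolynomial

variable {R : Type*} [CommSemiring R] {k l : ℕ}

/-- The concatenation of two exponent vectors. -/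
noncomputable def appendExponent (a : Fin k →₀ ℕ) (b : Fin l →₀ ℕ) : Fin (k + l) →₀ ℕ :=
  Finsupp.equivFunOnFinite.symm (Fin.append a b)

@[simp]
lemma appendExponent_castAdd (a : Fin k →₀ ℕ) (b : Fin l →₀ ℕ) (i : Fin k) :
    appendExponent a b (Fin.castAdd l i) = a i :=
  Fin.append_left a b i

@[simp]
lemma appendExponent_natAdd (a : Fin k →₀ ℕ) (b : Fin l →₀ ℕ) (i : Fin l) :
    appendExponent a b (Fin.natAdd k i) = b i :=
  Fin.append_right a b i

lemma appendExponent_inj {a a' : Fin k →₀ ℕ} {b b' : Fin l →₀ ℕ} :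
    appendExponent a b = appendExponent a' b' ↔ a = a' ∧ b = b' := by
  refine ⟨fun h => ⟨?_, ?_⟩, fun ⟨ha, hb⟩ => by rw [ha, hb]⟩
  · ext i
    simpa using DFunLike.congr_fun h (Fin.castAdd l i)
  · ext i
    simpa using DFunLike.congr_fun h (Fin.natAdd k i)

lemma exists_appendExponent_eq (d : Fin (k + l) →₀ ℕ) :
    ∃ (a : Fin k →₀ ℕ) (b : Fin l →₀ ℕ), appendExponent a b = d := by
  refine ⟨Finsupp.equivFunOnFinite.symm fun i => d (Fin.castAdd l i),
    Finsupp.equivFunOnFinite.symm fun i => d (Fin.natAdd k i), ?_⟩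
  ext i
  refine Fin.addCases (fun i => ?_) (fun i => ?_) i <;> simp

lemma mapDomain_castAdd_add_mapDomain_natAdd (a : Fin k →₀ ℕ) (b : Fin l →₀ ℕ) :
    Finsupp.mapDomain (Fin.castAdd l) a + Finsupp.mapDomain (Fin.natAdd k) b =
      appendExponent a b := by
  have hca := Fin.castAdd_injective k l
  have hna := Fin.natAdd_injective l k
  have hne (i : Fin k) (j : Fin l) : Fin.castAdd l i ≠ Fin.natAdd k j := by
    simp only [ne_eq, Fin.ext_iff, Fin.val_castAdd, Fin.val_natAdd]
    omega
  ext i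
  refine Fin.addCases (fun i => ?_) (fun i => ?_) i
  · rw [Finsupp.add_apply, Finsupp.mapDomain_apply hca, appendExponent_castAdd,
      Finsupp.mapDomain_of_notMem_range, add_zero]
    exact fun ⟨j, hj⟩ => hne i j hj.symm
  · rw [Finsupp.add_apply, Finsupp.mapDomain_apply hna, appendExponent_natAdd,
      Finsupp.mapDomain_of_notMem_range, zero_add]
    exact fun ⟨j, hj⟩ => hne j i hj

/-- The external product `p(x_1, …, x_k) q(x_{k+1}, …, x_{k+l})`, that is the image of `p ⊗ q` in
the polynomials in `k + l` variables. -/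
noncomputable def externalMul (p : MvPolynomial (Fin k) R) (q : MvPolynomial (Fin l) R) :
    MvPolynomial (Fin (k + l)) R :=
  rename (Fin.castAdd l) p * rename (Fin.natAdd k) q

lemma externalMul_monomial (a : Fin k →₀ ℕ) (b : Fin l →₀ ℕ) (c c' : R) :
    externalMul (monomial a c) (monomial b c') = monomial (appendExponent a b) (c * c') := by
  rw [externalMul, rename_monomial, rename_monomial, monomial_mul,
    mapDomain_castAdd_add_mapDomain_natAdd]

lemma coeff_externalMul (p : MvPolynomial (Fin k) R) (q : MvPolynomial (Fin l) R)
    (a : Fin k →₀ ℕ) (b : Fin l →₀ ℕ) :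
    coeff (appendExponent a b) (externalMul p q) = coeff a p * coeff b q := by
  classical
  induction p using MvPolynomial.induction_on' with
  | add p₁ p₂ h₁ h₂ =>
    simp only [externalMul, map_add, add_mul, coeff_add] at h₁ h₂ ⊢
    rw [h₁, h₂]
  | monomial a' c =>
    induction q using MvPolynomial.induction_on' with
    | add q₁ q₂ h₁ h₂ =>
      simp only [externalMul, map_add, mul_add, coeff_add] at h₁ h₂ ⊢
      rw [h₁, h₂]
    | monomial b' c' =>
      simp only [externalMul_monomial, coeff_monomial, appendExponent_inj, ite_zero_mul_ite_zero]

lemma aeval_externalMul {A : Type*} [CommSemiring A] [Algebra R A] (F : Fin (k + l) → A)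
    (p : MvPolynomial (Fin k) R) (q : MvPolynomial (Fin l) R) :
    aeval F (externalMul p q) =
      aeval (fun i => F (Fin.castAdd l i)) p * aeval (fun i => F (Fin.natAdd k i)) q := by
  rw [externalMul, map_mul, aeval_rename, aeval_rename]
  rfl

end ExternalProduct

section EvenPolynomials

lemma mem_oddIndices {N r : ℕ} {n : Fin r → ℕ} :
    n ∈ oddIndices N r ↔ ∑ i, n i = N ∧ ∀ i, 3 ≤ n i ∧ Odd (n i) := by
  simp [oddIndices, Finset.Nat.mem_antidiagonalTuple]

lemma shiftedExponent_apply {r : ℕ} (n : Fin r → ℕ) (i : Fin r) :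
    shiftedExponent n i = n i - 1 := rfl

lemma shiftedExponent_append {k l : ℕ} (a : Fin k → ℕ) (t : Fin l → ℕ) :
    shiftedExponent (Fin.append a t) = appendExponent (shiftedExponent a) (shiftedExponent t) := by
  ext i
  refine Fin.addCases (fun i => ?_) (fun i => ?_) i <;> simp [shiftedExponent_apply]

lemma shiftedExponent_injOn (r : ℕ) : Set.InjOn shiftedExponent {n : Fin r → ℕ | ∀ i, 1 ≤ n i} := by
  intro m hm n hn h
  funext i
  have hi : m i - 1 = n i - 1 := DFunLike.congr_fun h i
  have := hm i
  have := hn i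
  omega

variable {N r : ℕ}

lemma shiftedExponent_eq_iff {M : ℕ} {m : OddIdx N r} {n : OddIdx M r} :
    shiftedExponent m.1 = shiftedExponent n.1 ↔ m.1 = n.1 :=
  (shiftedExponent_injOn r).eq_iff (fun i => by linarith [((mem_oddIndices.1 m.2).2 i).1])
    fun i => by linarith [((mem_oddIndices.1 n.2).2 i).1]

lemma shiftedExponent_even_and_two_le (n : OddIdx N r) (i : Fin r) :
    Even (shiftedExponent n.1 i) ∧ 2 ≤ shiftedExponent n.1 i := by
  obtain ⟨h3, hodd⟩ := (mem_oddIndices.1 n.2).2 i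
  exact ⟨Nat.Odd.sub_odd hodd odd_one, Nat.le_sub_one_of_lt h3⟩

/-- The basis of `V_{N,r}` consisting of the monomials `x_1^{n_1-1} ⋯ x_r^{n_r-1}`. -/
noncomputable def evenMonomials (N r : ℕ) : Module.Basis (OddIdx N r) ℚ (evenPolys N r) :=
  .span <| (MvPolynomial.basisMonomials (Fin r) ℚ).linearIndependent.comp
    (fun m : OddIdx N r => shiftedExponent m.1)
    fun _ _ h => Subtype.ext (shiftedExponent_eq_iff.1 h)

lemma coe_evenMonomials (m : OddIdx N r) :
    (evenMonomials N r m : MvPolynomial (Fin r) ℚ) =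
      MvPolynomial.monomial (shiftedExponent m.1) 1 :=
  congrArg Subtype.val (Module.Basis.span_apply _ m)

lemma evenMonomials_equivFun_apply (P : evenPolys N r) (n : OddIdx N r) :
    (evenMonomials N r).equivFun P n = MvPolynomial.coeff (shiftedExponent n.1) P.1 := by
  classical
  have hcoeff : (evenMonomials N r).equivFun.toLinearMap = coeffVector N r := by
    refine (evenMonomials N r).ext fun m => funext fun n => ?_
    have hentry : coeffVector N r (evenMonomials N r m) n = if m = n then 1 else 0 := by
      rw [coeffVector, LinearMap.coe_mk, AddHom.coe_mk, coe_evenMonomials,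
        MvPolynomial.coeff_monomial]
      simp only [shiftedExponent_eq_iff, Subtype.coe_inj]
    rw [LinearEquiv.coe_coe, Module.Basis.equivFun_self, hentry]
  exact congrFun (LinearMap.congr_fun hcoeff P) n

instance (N r : ℕ) : FiniteDimensional ℚ (evenPolys N r) :=
  (evenMonomials N r).finiteDimensional_of_finite

lemma coeff_totallyEvenPart (Q : MvPolynomial (Fin r) ℚ) {d : Fin r →₀ ℕ}
    (hd : ∀ i, Even (d i) ∧ 2 ≤ d i) :
    MvPolynomial.coeff d (totallyEvenPart r Q) = MvPolynomial.coeff d Q := by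
  classical
  simp only [totallyEvenPart, LinearMap.coe_mk, AddHom.coe_mk, MvPolynomial.coeff_sum,
    MvPolynomial.coeff_monomial, Finset.sum_ite_eq', Finset.mem_filter,
    MvPolynomial.mem_support_iff, hd, implies_true, and_true, ite_not]
  split_ifs with h
  · exact h.symm
  · rfl

lemma evenMonomials_equivFun_phi {j : ℕ} (P : evenPolys N r) (n : OddIdx N r) :
    (evenMonomials N r).equivFun (phi N r j P) n =
      MvPolynomial.coeff (shiftedExponent n.1) (phiPoly r j P.1) := by
  rw [evenMonomials_equivFun_apply]
  exact coeff_totallyEvenPart _ (shiftedExponent_even_and_two_le n)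

end EvenPolynomials

section PhiPolynomials

open MvPolynomial

variable {k l j i p x : ℕ}

lemma polyVar_succ (i : Fin k) : polyVar k (i.val + 1) = X i :=
  dif_pos i.2

lemma polyVar_natAdd (k l : ℕ) (hx : 1 ≤ x) :
    polyVar (k + l) (k + x) = rename (Fin.natAdd k) (polyVar l x) := by
  unfold polyVar
  by_cases h : x - 1 < l
  · rw [dif_pos h, dif_pos (by omega), rename_X]
    congr 1
    ext
    simp only [Fin.val_natAdd]
    omega
  · rw [dif_neg h, dif_neg (by omega), map_zero]

lemma omitVar_natAdd (k l p : ℕ) (hx : 1 ≤ x) :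
    omitVar (k + l) (k + p) (k + x) = rename (Fin.natAdd k) (omitVar l p x) := by
  unfold omitVar
  simp only [add_lt_add_iff_left]
  split_ifs
  · exact polyVar_natAdd k l hx
  · exact polyVar_natAdd k l (Nat.le_succ_of_le hx)

lemma phiArg_castAdd (hj : j ≤ l) (x : Fin k) :
    phiArg (k + l) j i p (x.val + 1) = rename (Fin.castAdd l) (X x) := by
  rw [phiArg, if_pos (by omega), rename_X, ← polyVar_succ, Fin.val_castAdd]

lemma phiArg_natAdd (k : ℕ) (hj : j ≤ l) (hi : 1 ≤ i) (hx : 1 ≤ x) :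
    phiArg (k + l) j (k + i) (k + p) (k + x) = rename (Fin.natAdd k) (phiArg l j i p x) := by
  unfold phiArg
  rw [Nat.add_sub_assoc hj, add_assoc k (l - j) 1, add_assoc k i 1]
  simp only [add_le_add_iff_left, add_right_inj]
  split_ifs
  · exact polyVar_natAdd k l hx
  · rw [map_sub, polyVar_natAdd k l (Nat.le_add_left 1 i), polyVar_natAdd k l hi]
  · rw [Nat.add_sub_assoc hx, omitVar_natAdd k l p (by omega)]

lemma aeval_phiArg_externalMul (hj : j ≤ l) (hi : 1 ≤ i) (f : MvPolynomial (Fin k) ℚ)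
    (g : MvPolynomial (Fin l) ℚ) :
    aeval (fun x : Fin (k + l) => phiArg (k + l) j (k + i) (k + p) (x.val + 1))
        (externalMul f g) =
      externalMul f (aeval (fun x : Fin l => phiArg l j i p (x.val + 1)) g) := by
  rw [aeval_externalMul, externalMul]
  congr 1
  · simp only [Fin.val_castAdd, phiArg_castAdd hj, ← comp_aeval_apply, aeval_X_left_apply]
  · simp only [Fin.val_natAdd, add_assoc, phiArg_natAdd k hj hi (Nat.le_add_left 1 _),
      ← comp_aeval_apply]

lemma phiPoly_externalMul (hj : j ≤ l) (f : MvPolynomial (Fin k) ℚ) (g : MvPolynomial (Fin l) ℚ) :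
    phiPoly (k + l) j (externalMul f g) = externalMul f (phiPoly l j g) := by
  simp only [phiPoly, LinearMap.add_apply, LinearMap.id_apply, LinearMap.sum_apply,
    LinearMap.sub_apply, AlgHom.toLinearMap_apply]
  rw [Nat.add_sub_assoc hj, add_assoc, ← Finset.map_add_left_Ico, Finset.sum_map]
  have hterm : ∀ i ∈ Finset.Ico (l - j + 1) l,
      aeval (fun x : Fin (k + l) => phiArg (k + l) j (k + i) (k + i + 1) (x.val + 1))
          (externalMul f g) -
        aeval (fun x : Fin (k + l) => phiArg (k + l) j (k + i) (k + i) (x.val + 1))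
          (externalMul f g) =
      rename (Fin.castAdd l) f * rename (Fin.natAdd k)
        (aeval (fun x : Fin l => phiArg l j i (i + 1) (x.val + 1)) g -
          aeval (fun x : Fin l => phiArg l j i i (x.val + 1)) g) := fun i hi => by
    have h1 : 1 ≤ i := by linarith [(Finset.mem_Ico.1 hi).1]
    rw [add_assoc k i 1, aeval_phiArg_externalMul hj h1, aeval_phiArg_externalMul hj h1, map_sub,
      mul_sub, externalMul, externalMul]
  simp only [addLeftEmbedding_apply]
  rw [Finset.sum_congr rfl hterm, externalMul, externalMul, map_add, map_sum, mul_add,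
    Finset.mul_sum]

lemma phiPoly_one {r : ℕ} (hr : 1 ≤ r) : phiPoly r 1 = LinearMap.id := by
  simp [phiPoly, Nat.sub_add_cancel hr]

lemma monomial_one_eq_prod {σ R : Type*} [Fintype σ] [CommSemiring R] (s : σ →₀ ℕ) :
    monomial s (1 : R) = ∏ x, X x ^ s x := by
  rw [monomial_eq, map_one, one_mul, Finsupp.prod_fintype _ _ fun _ => pow_zero _]

lemma aeval_phiArg_self_monomial (i p : ℕ) (s : Fin (l + 1) →₀ ℕ) :
    aeval (fun x : Fin (l + 1) => phiArg (l + 1) (l + 1) i p (x.val + 1)) (monomial s (1 : ℚ)) =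
      (polyVar (l + 1) (i + 1) - polyVar (l + 1) i) ^ s 0 *
        aeval (fun x : Fin l => omitVar (l + 1) p (x.val + 1))
          (∏ x, (X x : MvPolynomial (Fin l) ℚ) ^ s x.succ) := by
  have hhead : phiArg (l + 1) (l + 1) i p ((0 : Fin (l + 1)).val + 1) =
      polyVar (l + 1) (i + 1) - polyVar (l + 1) i := by
    simp [phiArg]
  have htail (x : Fin l) : phiArg (l + 1) (l + 1) i p (x.succ.val + 1) =
      omitVar (l + 1) p (x.val + 1) := by
    simp [phiArg]
  simp only [monomial_one_eq_prod, Fin.prod_univ_succ, map_mul, map_prod, map_pow, aeval_X, hhead,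
    htail]

/- The exponent of the first variable being even, the sign in the Ihara action disappears and
`x_i - x_{i+1}` may be replaced by `x_{i+1} - x_i`. -/
lemma phiPoly_self_monomial {s : Fin (l + 1) →₀ ℕ} (hs : Even (s 0)) :
    phiPoly (l + 1) (l + 1) (monomial s 1) =
      iharaAction (l + 1) (Polynomial.X ^ s 0) (∏ x : Fin l, X x ^ s x.succ) := by
  have hneg (i : ℕ) : (polyVar (l + 1) i - polyVar (l + 1) (i + 1)) ^ s 0 =
      (polyVar (l + 1) (i + 1) - polyVar (l + 1) i) ^ s 0 := by
    rw [← neg_sub, hs.neg_pow]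
  have hhead : monomial s (1 : ℚ) = polyVar (l + 1) 1 ^ s 0 *
      aeval (fun x : Fin l => polyVar (l + 1) (x.val + 2))
        (∏ x, (X x : MvPolynomial (Fin l) ℚ) ^ s x.succ) := by
    simp only [monomial_one_eq_prod, map_prod, map_pow, aeval_X, Fin.prod_univ_succ]
    exact congrArg₂ _ (congrArg (· ^ _) (polyVar_succ 0).symm)
      (Finset.prod_congr rfl fun x _ => congrArg (· ^ _) (polyVar_succ x.succ).symm)
  simp only [phiPoly, LinearMap.add_apply, LinearMap.id_apply, LinearMap.sum_apply,
    LinearMap.sub_apply, AlgHom.toLinearMap_apply, aeval_phiArg_self_monomial, iharaAction,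
    Polynomial.natDegree_X_pow, hs.neg_one_pow, one_mul, map_pow, Polynomial.aeval_X, hneg,
    Nat.sub_self, zero_add]
  exact congrArg (· + _) hhead

end PhiPolynomials

section IharaMatrices

open MvPolynomial

lemma iharaCoeff_congr {r : ℕ} {m m' n n' : ℕ → ℕ} (hr : 1 ≤ r)
    (hm : ∀ x < r, m (x + 1) = m' (x + 1)) (hn : ∀ x < r, n (x + 1) = n' (x + 1)) :
    iharaCoeff r m n = iharaCoeff r m' n' := by
  have hexp : (fun x : Fin r => n (x.val + 1)) = fun x => n' (x.val + 1) :=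
    funext fun x => hn x x.2
  have htail : ∀ x : Fin (r - 1), m (x.val + 2) = m' (x.val + 2) :=
    fun x => hm (x + 1) (by omega)
  simp only [iharaCoeff, hexp, htail, hm 0 hr]

lemma tupleEntry_succ {r : ℕ} (m : Fin r → ℕ) (x : Fin r) : tupleEntry m (x.val + 1) = m x :=
  dif_pos x.2

lemma coeff_phiPoly_self_monomial {l : ℕ} {m : Fin (l + 1) → ℕ} (n : Fin (l + 1) → ℕ)
    (hm : Even (shiftedExponent m 0)) :
    coeff (shiftedExponent n) (phiPoly (l + 1) (l + 1) (monomial (shiftedExponent m) 1)) =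
      iharaCoeff (l + 1) (tupleEntry m) (tupleEntry n) := by
  have htail (x : Fin l) : tupleEntry m (x.val + 2) = m x.succ := tupleEntry_succ m x.succ
  have hhead : tupleEntry m 1 = m 0 := tupleEntry_succ m 0
  rw [phiPoly_self_monomial hm, iharaCoeff]
  simp only [tupleEntry_succ, htail, hhead, shiftedExponent_apply]
  rfl

variable {N r j : ℕ}

lemma matEj_apply_eq_coeff (hj : 1 ≤ j) (hjr : j ≤ r) (m n : OddIdx N r) :
    matEj N r j m n =
      coeff (shiftedExponent n.1) (phiPoly r j (monomial (shiftedExponent m.1) 1)) := by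
  classical
  obtain ⟨l, rfl⟩ := Nat.exists_eq_add_of_le' hj
  obtain ⟨k, rfl⟩ := Nat.exists_eq_add_of_le' hjr
  set head : (Fin (k + (l + 1)) → ℕ) → Fin k → ℕ := fun m i => m (Fin.castAdd (l + 1) i)
  set tail : (Fin (k + (l + 1)) → ℕ) → Fin (l + 1) → ℕ := fun m i => m (Fin.natAdd k i)
  have hsplit (m) : shiftedExponent m =
      appendExponent (shiftedExponent (head m)) (shiftedExponent (tail m)) := by
    rw [← shiftedExponent_append, Fin.append_castAdd_natAdd]
  have hentry (m : Fin (k + (l + 1)) → ℕ) (x : ℕ) (hx : x < l + 1) :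
      tupleEntry m (k + (x + 1)) = tupleEntry (tail m) (x + 1) :=
    (tupleEntry_succ m (Fin.natAdd k ⟨x, hx⟩)).trans (tupleEntry_succ (tail m) ⟨x, hx⟩).symm
  have heven : Even (shiftedExponent (tail m.1) 0) := (shiftedExponent_even_and_two_le m _).1
  have hpos (m : OddIdx N (k + (l + 1))) : head m.1 ∈ {n : Fin k → ℕ | ∀ i, 1 ≤ n i} :=
    fun i => by linarith [((mem_oddIndices.1 m.2).2 (Fin.castAdd (l + 1) i)).1]
  rw [hsplit m.1, hsplit n.1, ← mul_one (1 : ℚ), ← externalMul_monomial,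
    phiPoly_externalMul le_rfl, coeff_externalMul, coeff_phiPoly_self_monomial _ heven,
    coeff_monomial, ite_mul, one_mul, zero_mul, matEj, Matrix.of_apply, Nat.add_sub_cancel]
  refine if_congr ?_ (iharaCoeff_congr hj (hentry m.1) (hentry n.1)) rfl
  rw [(shiftedExponent_injOn k).eq_iff (hpos m) (hpos n), funext_iff]
  exact ⟨fun h i => h (Fin.castAdd (l + 1) i) i.2, fun h i hi => h ⟨i, hi⟩⟩

lemma evenMonomials_equivFun_phi_eq_vecMul (hj : 1 ≤ j) (hjr : j ≤ r) (P : evenPolys N r) :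
    (evenMonomials N r).equivFun (phi N r j P) =
      Matrix.vecMul ((evenMonomials N r).equivFun P) (matEj N r j) := by
  classical
  suffices h : (evenMonomials N r).equivFun.toLinearMap ∘ₗ phi N r j =
      (matEj N r j).vecMulLinear ∘ₗ (evenMonomials N r).equivFun.toLinearMap from
    LinearMap.congr_fun h P
  refine (evenMonomials N r).ext fun m => funext fun n => ?_
  have hsingle : (evenMonomials N r).equivFun (evenMonomials N r m) = Pi.single m 1 := by
    rw [Module.Basis.equivFun_apply, Module.Basis.repr_self, Finsupp.single_eq_pi_single]
  rw [LinearMap.comp_apply, LinearMap.comp_apply, LinearEquiv.coe_coe,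
    evenMonomials_equivFun_phi, coe_evenMonomials, ← matEj_apply_eq_coeff hj hjr, hsingle,
    Matrix.vecMulLinear_apply, Matrix.single_one_vecMul, Matrix.row]

lemma matEj_self (N r : ℕ) : matEj N r r = matE N r := by
  ext m n
  simp [matEj, matE]

lemma matEj_one (hr : 1 ≤ r) : matEj N r 1 = 1 := by
  classical
  ext m n
  rw [matEj_apply_eq_coeff le_rfl hr, phiPoly_one hr, LinearMap.id_apply, coeff_monomial,
    Matrix.one_apply]
  simp only [shiftedExponent_eq_iff, Subtype.coe_inj]

/-- The partial product `E^{(2)}_{N,r} ⋯ E^{(j)}_{N,r}` of the matrices whose full product is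
`C_{N,r}`. -/
noncomputable def matEprod (N r j : ℕ) : Matrix (OddIdx N r) (OddIdx N r) ℚ :=
  ((List.range' 2 (j - 1)).map (matEj N r)).prod

lemma matEprod_succ (hj : 1 ≤ j) :
    matEprod N r (j + 1) = matEprod N r j * matEj N r (j + 1) := by
  obtain ⟨i, rfl⟩ := Nat.exists_eq_add_of_le' hj
  rw [matEprod, matEprod, Nat.add_sub_cancel, Nat.add_sub_cancel, List.range'_concat,
    List.map_append, List.prod_append, List.map_singleton, List.prod_singleton, one_mul,
    show 2 + i = i + 1 + 1 by omega]

lemma matEprod_self (hr : 1 ≤ r) : matEprod N r r = matC N r := by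
  obtain ⟨i, rfl⟩ := Nat.exists_eq_add_of_le' hr
  rcases Nat.eq_zero_or_pos i with rfl | hi
  · simp [matEprod, matC, ← matEj_self, matEj_one]
  · rw [matEprod_succ hi, matC, matEj_self]
    rfl

lemma phiComp_one : phiComp N r 1 = LinearMap.id := rfl

lemma phiComp_succ (hj : 1 ≤ j) : phiComp N r (j + 1) = phi N r (j + 1) ∘ₗ phiComp N r j := by
  obtain ⟨i, rfl⟩ := Nat.exists_eq_add_of_le' hj
  rfl

lemma evenMonomials_equivFun_phiComp (hj : 1 ≤ j) (hjr : j ≤ r) (P : evenPolys N r) :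
    (evenMonomials N r).equivFun (phiComp N r j P) =
      Matrix.vecMul ((evenMonomials N r).equivFun P) (matEprod N r j) := by
  induction j, hj using Nat.le_induction with
  | base => simp [phiComp, matEprod]
  | succ j hj ih =>
    rw [matEprod_succ hj, ← Matrix.vecMul_vecMul, ← ih (by omega), phiComp_succ hj,
      LinearMap.comp_apply, evenMonomials_equivFun_phi_eq_vecMul (by omega) hjr]

lemma rank_matC_eq_finrank_range_phiComp (hr : 1 ≤ r) :
    (matC N r).rank = Module.finrank ℚ (LinearMap.range (phiComp N r r)) := by
  have hconj : (matC N r).vecMulLinear ∘ₗ (evenMonomials N r).equivFun.toLinearMap =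
      (evenMonomials N r).equivFun.toLinearMap ∘ₗ phiComp N r r := by
    refine LinearMap.ext fun P => ?_
    rw [← matEprod_self hr]
    exact (evenMonomials_equivFun_phiComp hr le_rfl P).symm
  rw [rank_eq_finrank_range_vecMulLinear,
    ← LinearMap.range_comp_of_range_eq_top _ (LinearEquiv.range (evenMonomials N r).equivFun),
    hconj, LinearMap.range_comp, LinearEquiv.finrank_map_eq]

end IharaMatrices

section PartialCoefficients

open MvPolynomial

variable {R : Type*} [CommSemiring R] {k l : ℕ}

lemma appendExponent_left_injective (b : Fin l →₀ ℕ) :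
    Function.Injective fun a : Fin k →₀ ℕ => appendExponent a b :=
  fun _ _ h => (appendExponent_inj.1 h).1

lemma appendExponent_right_injective (a : Fin k →₀ ℕ) :
    Function.Injective (appendExponent a : (Fin l →₀ ℕ) → _) :=
  fun _ _ h => (appendExponent_inj.1 h).2

/-- The coefficient of `x_1^{a_1} ⋯ x_k^{a_k}` in a polynomial in `k + l` variables, as a polynomial
in the last `l` variables. -/
noncomputable def headCoeff (a : Fin k →₀ ℕ) :
    MvPolynomial (Fin (k + l)) R →ₗ[R] MvPolynomial (Fin l) R :=
  (AddMonoidAlgebra.coeffLinearEquiv R).symm.toLinearMap ∘ₗ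
    Finsupp.lcomapDomain _ (appendExponent_right_injective a) ∘ₗ
      (AddMonoidAlgebra.coeffLinearEquiv R).toLinearMap

/-- The coefficient of `x_{k+1}^{b_1} ⋯ x_{k+l}^{b_l}` in a polynomial in `k + l` variables, as a
polynomial in the first `k` variables. -/
noncomputable def tailCoeff (b : Fin l →₀ ℕ) :
    MvPolynomial (Fin (k + l)) R →ₗ[R] MvPolynomial (Fin k) R :=
  (AddMonoidAlgebra.coeffLinearEquiv R).symm.toLinearMap ∘ₗ
    Finsupp.lcomapDomain _ (appendExponent_left_injective b) ∘ₗ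
      (AddMonoidAlgebra.coeffLinearEquiv R).toLinearMap

lemma coeff_headCoeff (a : Fin k →₀ ℕ) (b : Fin l →₀ ℕ) (P : MvPolynomial (Fin (k + l)) R) :
    coeff b (headCoeff a P) = coeff (appendExponent a b) P := rfl

lemma coeff_tailCoeff (a : Fin k →₀ ℕ) (b : Fin l →₀ ℕ) (P : MvPolynomial (Fin (k + l)) R) :
    coeff a (tailCoeff b P) = coeff (appendExponent a b) P := rfl

lemma headCoeff_externalMul (a : Fin k →₀ ℕ) (f : MvPolynomial (Fin k) R)
    (g : MvPolynomial (Fin l) R) : headCoeff a (externalMul f g) = coeff a f • g := by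
  ext b
  rw [coeff_headCoeff, coeff_externalMul, coeff_smul, smul_eq_mul]

lemma tailCoeff_externalMul (b : Fin l →₀ ℕ) (f : MvPolynomial (Fin k) R)
    (g : MvPolynomial (Fin l) R) : tailCoeff b (externalMul f g) = coeff b g • f := by
  ext a
  rw [coeff_tailCoeff, coeff_externalMul, coeff_smul, smul_eq_mul, mul_comm]

lemma eq_zero_of_forall_tailCoeff_eq_zero {P : MvPolynomial (Fin (k + l)) R}
    (h : ∀ b, tailCoeff b P = 0) : P = 0 := by
  ext d
  obtain ⟨a, b, rfl⟩ := exists_appendExponent_eq d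
  rw [← coeff_tailCoeff, h]
  rfl

lemma linearMap_ext_externalMul {M : Type*} [AddCommMonoid M] [Module R M]
    {φ ψ : MvPolynomial (Fin (k + l)) R →ₗ[R] M}
    (h : ∀ f g, φ (externalMul f g) = ψ (externalMul f g)) : φ = ψ := by
  refine (basisMonomials (Fin (k + l)) R).ext fun d => ?_
  obtain ⟨a, b, rfl⟩ := exists_appendExponent_eq d
  have hsplit := externalMul_monomial a b (1 : R) 1
  rw [mul_one] at hsplit
  simpa only [coe_basisMonomials, hsplit] using h (monomial a 1) (monomial b 1)

lemma headCoeff_phiPoly {j : ℕ} (hj : j ≤ l) (a : Fin k →₀ ℕ) (P : MvPolynomial (Fin (k + l)) ℚ) :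
    headCoeff a (phiPoly (k + l) j P) = phiPoly l j (headCoeff a P) := by
  suffices h : headCoeff a ∘ₗ phiPoly (k + l) j = phiPoly l j ∘ₗ headCoeff a from
    LinearMap.congr_fun h P
  refine linearMap_ext_externalMul fun f g => ?_
  rw [LinearMap.comp_apply, LinearMap.comp_apply, phiPoly_externalMul hj, headCoeff_externalMul,
    headCoeff_externalMul, map_smul]

end PartialCoefficients

section Slices

open MvPolynomial
open Finset.HasAntidiagonal (antidiagonal mem_antidiagonal)

variable {N k l : ℕ}

/-- The concatenation of two totally odd indices. -/
def OddIdx.append (p : antidiagonal N) (a : OddIdx p.1.1 k) (b : OddIdx p.1.2 l) :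
    OddIdx N (k + l) :=
  ⟨Fin.append a.1 b.1, by
    obtain ⟨ha, ha'⟩ := mem_oddIndices.1 a.2
    obtain ⟨hb, hb'⟩ := mem_oddIndices.1 b.2
    refine mem_oddIndices.2 ⟨?_, Fin.addCases (fun i => ?_) fun i => ?_⟩
    · simp only [Fin.sum_univ_add, Fin.append_left, Fin.append_right, ha, hb,
        mem_antidiagonal.1 p.2]
    · rw [Fin.append_left]
      exact ha' i
    · rw [Fin.append_right]
      exact hb' i⟩

lemma OddIdx.shiftedExponent_append (p : antidiagonal N) (a : OddIdx p.1.1 k)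
    (b : OddIdx p.1.2 l) :
    shiftedExponent (OddIdx.append p a b).1 =
      appendExponent (shiftedExponent a.1) (shiftedExponent b.1) :=
  _root_.shiftedExponent_append a.1 b.1

lemma OddIdx.exists_append_eq (m : OddIdx N (k + l)) :
    ∃ (p : antidiagonal N) (a : OddIdx p.1.1 k) (b : OddIdx p.1.2 l),
      OddIdx.append p a b = m := by
  obtain ⟨hsum, hodd⟩ := mem_oddIndices.1 m.2
  rw [Fin.sum_univ_add] at hsum
  exact ⟨⟨(_, _), mem_antidiagonal.2 hsum⟩,
    ⟨fun i => m.1 (Fin.castAdd l i), mem_oddIndices.2 ⟨rfl, fun i => hodd _⟩⟩,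
    ⟨fun i => m.1 (Fin.natAdd k i), mem_oddIndices.2 ⟨rfl, fun i => hodd _⟩⟩,
    Subtype.ext Fin.append_castAdd_natAdd⟩

lemma OddIdx.append_bijective (N k l : ℕ) :
    Function.Bijective fun x : Σ p : antidiagonal N, OddIdx p.1.1 k × OddIdx p.1.2 l =>
      OddIdx.append x.1 x.2.1 x.2.2 := by
  constructor
  · rintro ⟨⟨⟨M₁, M₂⟩, hM⟩, ⟨a, ha⟩, ⟨b, hb⟩⟩ ⟨⟨⟨M₁', M₂'⟩, hM'⟩, ⟨a', ha'⟩, ⟨b', hb'⟩⟩ h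
    have happend : Fin.append a b = Fin.append a' b' := congrArg Subtype.val h
    obtain rfl : a = a' := funext fun i => by
      simpa only [Fin.append_left] using congrFun happend (Fin.castAdd l i)
    obtain rfl : b = b' := funext fun i => by
      simpa only [Fin.append_right] using congrFun happend (Fin.natAdd k i)
    obtain rfl : M₁ = M₁' := (mem_oddIndices.1 ha).1.symm.trans (mem_oddIndices.1 ha').1
    obtain rfl : M₂ = M₂' := (mem_oddIndices.1 hb).1.symm.trans (mem_oddIndices.1 hb').1
    rfl
  · intro m
    obtain ⟨p, a, b, rfl⟩ := m.exists_append_eq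
    exact ⟨⟨p, a, b⟩, rfl⟩

/-- The coefficients of an element of `V_{N,k+l}`, arranged into one matrix for each way
`p = (N₁, N₂)` of distributing the weight `N` among the first `k` and the last `l` entries. -/
noncomputable def coeffSlices (N k l : ℕ) : evenPolys N (k + l) ≃ₗ[ℚ]
    ∀ p : antidiagonal N, Matrix (OddIdx p.1.1 k) (OddIdx p.1.2 l) ℚ :=
  (evenMonomials N (k + l)).equivFun ≪≫ₗ
    LinearEquiv.funCongrLeft ℚ ℚ (Equiv.ofBijective _ (OddIdx.append_bijective N k l)) ≪≫ₗ
    LinearEquiv.piCurry ℚ (fun _ _ => ℚ) ≪≫ₗ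
    LinearEquiv.piCongrRight fun _ => LinearEquiv.curry ℚ ℚ _ _

lemma coeffSlices_apply (P : evenPolys N (k + l)) (p : antidiagonal N) (a : OddIdx p.1.1 k)
    (b : OddIdx p.1.2 l) :
    coeffSlices N k l P p a b =
      coeff (appendExponent (shiftedExponent a.1) (shiftedExponent b.1)) P.1 := by
  rw [← OddIdx.shiftedExponent_append, ← evenMonomials_equivFun_apply]
  rfl

lemma mem_evenPolys_iff {r : ℕ} {Q : MvPolynomial (Fin r) ℚ} :
    Q ∈ evenPolys N r ↔ ∀ d, coeff d Q ≠ 0 → ∃ m : OddIdx N r, shiftedExponent m.1 = d := by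
  have hrange : Set.range (fun m : OddIdx N r => monomial (shiftedExponent m.1) (1 : ℚ)) =
      (monomial · 1) '' Set.range fun m : OddIdx N r => shiftedExponent m.1 :=
    Set.range_comp (monomial · (1 : ℚ)) fun m : OddIdx N r => shiftedExponent m.1
  rw [evenPolys, hrange, ← restrictSupport_eq_span, mem_restrictSupport_iff]
  simp only [Set.subset_def, Finset.mem_coe, mem_support_iff, Set.mem_range]

lemma OddIdx.weight_eq_of_shiftedExponent_eq {M N r : ℕ} {m : OddIdx M r} {n : OddIdx N r}
    (h : shiftedExponent m.1 = shiftedExponent n.1) : M = N := by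
  rw [← (mem_oddIndices.1 m.2).1, ← (mem_oddIndices.1 n.2).1, shiftedExponent_eq_iff.1 h]

lemma headCoeff_mem_evenPolys (P : evenPolys N (k + l)) (p : antidiagonal N)
    (a : OddIdx p.1.1 k) : headCoeff (shiftedExponent a.1) P.1 ∈ evenPolys p.1.2 l := by
  refine mem_evenPolys_iff.2 fun d hd => ?_
  obtain ⟨m, hm⟩ := mem_evenPolys_iff.1 P.2 _ hd
  obtain ⟨⟨⟨M₁, M₂⟩, hM⟩, a', b, rfl⟩ := m.exists_append_eq
  obtain ⟨ha, hb⟩ := appendExponent_inj.1 ((OddIdx.shiftedExponent_append ..).symm.trans hm)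
  have hM₁ : M₁ = p.1.1 := OddIdx.weight_eq_of_shiftedExponent_eq ha
  obtain rfl : M₂ = p.1.2 := by
    have := mem_antidiagonal.1 hM
    have := mem_antidiagonal.1 p.2
    simp only at *
    omega
  exact ⟨b, hb⟩

lemma tailCoeff_mem_evenPolys (P : evenPolys N (k + l)) (p : antidiagonal N)
    (b : OddIdx p.1.2 l) : tailCoeff (shiftedExponent b.1) P.1 ∈ evenPolys p.1.1 k := by
  refine mem_evenPolys_iff.2 fun d hd => ?_
  obtain ⟨m, hm⟩ := mem_evenPolys_iff.1 P.2 _ hd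
  obtain ⟨⟨⟨M₁, M₂⟩, hM⟩, a, b', rfl⟩ := m.exists_append_eq
  obtain ⟨ha, hb⟩ := appendExponent_inj.1 ((OddIdx.shiftedExponent_append ..).symm.trans hm)
  have hM₂ : M₂ = p.1.2 := OddIdx.weight_eq_of_shiftedExponent_eq hb
  obtain rfl : M₁ = p.1.1 := by
    have := mem_antidiagonal.1 hM
    have := mem_antidiagonal.1 p.2
    simp only at *
    omega
  exact ⟨a, ha⟩

lemma coeffSlices_row (P : evenPolys N (k + l)) (p : antidiagonal N) (a : OddIdx p.1.1 k) :
    coeffSlices N k l P p a =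
      (evenMonomials p.1.2 l).equivFun ⟨_, headCoeff_mem_evenPolys P p a⟩ := by
  ext b
  rw [coeffSlices_apply, evenMonomials_equivFun_apply, coeff_headCoeff]

lemma coeffSlices_col (P : evenPolys N (k + l)) (p : antidiagonal N) (b : OddIdx p.1.2 l) :
    (coeffSlices N k l P p).col b =
      (evenMonomials p.1.1 k).equivFun ⟨_, tailCoeff_mem_evenPolys P p b⟩ := by
  ext a
  rw [Matrix.col_apply, coeffSlices_apply, evenMonomials_equivFun_apply, coeff_tailCoeff]

lemma coeffSlices_phi {j : ℕ} (hj : 1 ≤ j) (hjl : j ≤ l) (P : evenPolys N (k + l))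
    (p : antidiagonal N) :
    coeffSlices N k l (phi N (k + l) j P) p = coeffSlices N k l P p * matEj p.1.2 l j := by
  ext a b
  rw [Matrix.mul_apply_eq_vecMul, coeffSlices_row P, ← evenMonomials_equivFun_phi_eq_vecMul hj hjl,
    evenMonomials_equivFun_phi, ← headCoeff_phiPoly hjl, coeff_headCoeff, coeffSlices_apply,
    ← OddIdx.shiftedExponent_append, ← evenMonomials_equivFun_phi, evenMonomials_equivFun_apply]

lemma coeffSlices_phiComp {j : ℕ} (hj : 1 ≤ j) (hjl : j ≤ l) (P : evenPolys N (k + l))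
    (p : antidiagonal N) :
    coeffSlices N k l (phiComp N (k + l) j P) p = coeffSlices N k l P p * matEprod p.1.2 l j := by
  induction j, hj using Nat.le_induction with
  | base => simp [phiComp, matEprod]
  | succ j hj ih =>
    rw [phiComp_succ hj, LinearMap.comp_apply, coeffSlices_phi (by omega) hjl, ih (by omega),
      matEprod_succ hj, Matrix.mul_assoc]

lemma finrank_map_phiComp (hl : 1 ≤ l) {U : Submodule ℚ (evenPolys N (k + l))}
    {A : ∀ p : antidiagonal N, Submodule ℚ (OddIdx p.1.1 k → ℚ)}
    (hU : ∀ P, P ∈ U ↔ ∀ p, coeffSlices N k l P p ∈ columnsIn (A p) _) :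
    Module.finrank ℚ (U.map (phiComp N (k + l) l)) =
      ∑ p : antidiagonal N, Module.finrank ℚ (A p) * (matC p.1.2 l).rank := by
  have hmap : U.map (coeffSlices N k l).toLinearMap =
      Submodule.pi Set.univ fun p => columnsIn (A p) _ := by
    ext X
    obtain ⟨P, rfl⟩ := (coeffSlices N k l).surjective X
    simp [hU, Submodule.mem_pi]
  have hcomp : (coeffSlices N k l).toLinearMap ∘ₗ phiComp N (k + l) l =
      LinearMap.piMap (fun p : antidiagonal N => mulRightLinearMap _ ℚ (matC p.1.2 l)) ∘ₗ
        (coeffSlices N k l).toLinearMap := by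
    refine LinearMap.ext fun P => funext fun p => (coeffSlices_phiComp hl le_rfl P p).trans ?_
    rw [matEprod_self hl]
    rfl
  rw [← LinearEquiv.finrank_map_eq (coeffSlices N k l), ← Submodule.map_comp, hcomp,
    Submodule.map_comp, hmap, finrank_map_piMap_submodulePi]
  exact Finset.sum_congr rfl fun p _ => finrank_map_mulRightLinearMap_columnsIn _ _

lemma finrank_range_phiComp (hl : 1 ≤ l) :
    Module.finrank ℚ (LinearMap.range (phiComp N (k + l) l)) =
      ∑ p ∈ antidiagonal N, Fintype.card (OddIdx p.1 k) * (matC p.2 l).rank := by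
  rw [← Submodule.map_top, finrank_map_phiComp hl (A := fun _ => ⊤) (by simp [mem_columnsIn])]
  simp only [finrank_top, Module.finrank_fintype_fun_eq_card]
  exact Finset.sum_coe_sort (antidiagonal N) fun p =>
    Fintype.card (OddIdx p.1 k) * (matC p.2 l).rank

end Slices

section PeriodPolynomials

open MvPolynomial
open Finset.HasAntidiagonal (antidiagonal mem_antidiagonal)

variable {N l : ℕ}

/-- The sequence `x_2 - x_1, x_j, x_3, …, x_r` substituted in the defining relation of `W_{N,r}`. -/
noncomputable def periodArg (r j : ℕ) (k : Fin r) : MvPolynomial (Fin r) ℚ :=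
  if k.val = 0 then polyVar r 2 - polyVar r 1
  else if k.val = 1 then polyVar r j else polyVar r (k.val + 1)

/-- The difference `P - P(x_2 - x_1, x_2, x_3, …) + P(x_2 - x_1, x_1, x_3, …)`, whose vanishing
defines `W_{N,r}`. -/
noncomputable def periodDefect (r : ℕ) : MvPolynomial (Fin r) ℚ →ₗ[ℚ] MvPolynomial (Fin r) ℚ :=
  LinearMap.id - ((aeval (periodArg r 2)).toLinearMap - (aeval (periodArg r 1)).toLinearMap)

lemma mem_periodPolys {r : ℕ} {P : evenPolys N r} :
    P ∈ periodPolys N r ↔ periodDefect r P.1 = 0 :=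
  sub_eq_zero.symm

lemma polyVar_castAdd {k x : ℕ} (hx : 1 ≤ x) (hxk : x ≤ k) :
    polyVar (k + l) x = rename (Fin.castAdd l) (polyVar k x) := by
  obtain ⟨i, rfl⟩ := Nat.exists_eq_add_of_le' hx
  rw [polyVar_succ ⟨i, hxk⟩, rename_X, ← polyVar_succ, Fin.val_castAdd]

lemma periodArg_castAdd {j : ℕ} (hj : 1 ≤ j) (hj₂ : j ≤ 2) (i : Fin 2) :
    periodArg (2 + l) j (Fin.castAdd l i) = rename (Fin.castAdd l) (periodArg 2 j i) := by
  unfold periodArg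
  rw [Fin.val_castAdd]
  split_ifs
  · rw [map_sub, polyVar_castAdd one_le_two le_rfl, polyVar_castAdd le_rfl one_le_two]
  · exact polyVar_castAdd hj hj₂
  · omega

lemma periodArg_natAdd (j : ℕ) (i : Fin l) :
    periodArg (2 + l) j (Fin.natAdd 2 i) = X (Fin.natAdd 2 i) := by
  rw [periodArg, Fin.val_natAdd, if_neg (by omega), if_neg (by omega), ← polyVar_succ,
    Fin.val_natAdd]

lemma aeval_periodArg_externalMul {j : ℕ} (hj : 1 ≤ j) (hj₂ : j ≤ 2)
    (f : MvPolynomial (Fin 2) ℚ) (g : MvPolynomial (Fin l) ℚ) :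
    aeval (periodArg (2 + l) j) (externalMul f g) = externalMul (aeval (periodArg 2 j) f) g := by
  rw [aeval_externalMul, externalMul]
  congr 1
  · simp only [periodArg_castAdd hj hj₂, ← comp_aeval_apply]
  · simp only [periodArg_natAdd, rename_eq_aeval]
    rfl

lemma periodDefect_externalMul (f : MvPolynomial (Fin 2) ℚ) (g : MvPolynomial (Fin l) ℚ) :
    periodDefect (2 + l) (externalMul f g) = externalMul (periodDefect 2 f) g := by
  simp only [periodDefect, LinearMap.sub_apply, LinearMap.id_apply, AlgHom.toLinearMap_apply,
    aeval_periodArg_externalMul, le_refl, Nat.one_le_ofNat]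
  simp only [externalMul, map_sub, sub_mul]

lemma tailCoeff_periodDefect (b : Fin l →₀ ℕ) (P : MvPolynomial (Fin (2 + l)) ℚ) :
    tailCoeff b (periodDefect (2 + l) P) = periodDefect 2 (tailCoeff b P) := by
  suffices h : tailCoeff b ∘ₗ periodDefect (2 + l) = periodDefect 2 ∘ₗ tailCoeff b from
    LinearMap.congr_fun h P
  refine linearMap_ext_externalMul fun f g => ?_
  rw [LinearMap.comp_apply, LinearMap.comp_apply, periodDefect_externalMul, tailCoeff_externalMul,
    tailCoeff_externalMul, map_smul]

lemma tailCoeff_eq_zero_or_exists_shiftedExponent_eq {k : ℕ} (P : evenPolys N (k + l))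
    (b : Fin l →₀ ℕ) : tailCoeff b P.1 = 0 ∨
      ∃ (p : antidiagonal N) (t : OddIdx p.1.2 l), shiftedExponent t.1 = b := by
  refine or_iff_not_imp_left.2 fun hb => ?_
  obtain ⟨a, ha⟩ := ne_zero_iff.1 hb
  obtain ⟨m, hm⟩ := mem_evenPolys_iff.1 P.2 _ ha
  obtain ⟨p, s, t, rfl⟩ := m.exists_append_eq
  exact ⟨p, t, (appendExponent_inj.1 ((OddIdx.shiftedExponent_append ..).symm.trans hm)).2⟩

/-- The coefficient vectors of the elements of `W_{N,2}`. -/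
noncomputable def periodVectors (N : ℕ) : Submodule ℚ (OddIdx N 2 → ℚ) :=
  (periodPolys N 2).map (evenMonomials N 2).equivFun.toLinearMap

lemma equivFun_mem_periodVectors {P : evenPolys N 2} :
    (evenMonomials N 2).equivFun P ∈ periodVectors N ↔ P ∈ periodPolys N 2 := by
  rw [periodVectors, Submodule.mem_map_equiv, LinearEquiv.symm_apply_apply]

lemma finrank_periodVectors (N : ℕ) :
    Module.finrank ℚ (periodVectors N) = Module.finrank ℚ (periodPolys N 2) :=
  LinearEquiv.finrank_map_eq _ _

lemma mem_periodPolys_iff_coeffSlices_mem {P : evenPolys N (2 + l)} :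
    P ∈ periodPolys N (2 + l) ↔
      ∀ p, coeffSlices N 2 l P p ∈ columnsIn (periodVectors p.1.1) _ := by
  simp only [mem_columnsIn, coeffSlices_col, equivFun_mem_periodVectors, mem_periodPolys,
    ← tailCoeff_periodDefect]
  refine ⟨fun h p b => by rw [h, map_zero],
    fun h => eq_zero_of_forall_tailCoeff_eq_zero fun b => ?_⟩
  rcases tailCoeff_eq_zero_or_exists_shiftedExponent_eq P b with hb | ⟨p, t, rfl⟩
  · rw [tailCoeff_periodDefect, hb, map_zero]
  · exact h p t

lemma finrank_map_phiComp_periodPolys (hl : 1 ≤ l) :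
    Module.finrank ℚ ((periodPolys N (2 + l)).map (phiComp N (2 + l) l)) =
      ∑ p ∈ antidiagonal N, Module.finrank ℚ (periodPolys p.1 2) * (matC p.2 l).rank := by
  rw [finrank_map_phiComp hl fun _ => mem_periodPolys_iff_coeffSlices_mem]
  simp only [finrank_periodVectors]
  exact Finset.sum_coe_sort (antidiagonal N) fun p =>
    Module.finrank ℚ (periodPolys p.1 2) * (matC p.2 l).rank

lemma phiComp_mem_periodPolys (hl : 1 ≤ l) {P : evenPolys N (2 + l)}
    (hP : P ∈ periodPolys N (2 + l)) : phiComp N (2 + l) l P ∈ periodPolys N (2 + l) := by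
  rw [mem_periodPolys_iff_coeffSlices_mem] at hP ⊢
  intro p
  rw [coeffSlices_phiComp hl le_rfl]
  exact map_mulRightLinearMap_columnsIn_le _ _ (Submodule.mem_map_of_mem (hP p))

end PeriodPolynomials

section FactorizationOfTasakaMap

open MvPolynomial

variable {N l : ℕ}

lemma aeval_evenPolys_congr {r : ℕ} {A : Type*} [CommRing A] [Algebra ℚ A] (P : evenPolys N r)
    {F G : Fin r → A} (h : ∀ i, F i = G i ∨ F i = -G i) : aeval F P.1 = aeval G P.1 := by
  suffices h : (aeval F).toLinearMap ∘ₗ (evenPolys N r).subtype =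
      (aeval G).toLinearMap ∘ₗ (evenPolys N r).subtype from LinearMap.congr_fun h P
  refine (evenMonomials N r).ext fun m => ?_
  simp only [LinearMap.comp_apply, Submodule.subtype_apply, AlgHom.toLinearMap_apply,
    coe_evenMonomials, monomial_one_eq_prod, map_prod, map_pow, aeval_X]
  refine Finset.prod_congr rfl fun i _ => ?_
  rcases h i with h | h
  · rw [h]
  · rw [h, (shiftedExponent_even_and_two_le m i).1.neg_pow]

lemma periodArg_eq_cons (l j : ℕ) :
    periodArg (l + 2) j = Fin.cons (polyVar (l + 2) 2 - polyVar (l + 2) 1)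
      (Fin.cons (polyVar (l + 2) j) fun i : Fin l => X i.succ.succ) := by
  funext i
  cases i using Fin.cases with
  | zero => rfl
  | succ i =>
    cases i using Fin.cases with
    | zero => rfl
    | succ i =>
      simp only [Fin.cons_succ, ← polyVar_succ]
      rfl

lemma aeval_cons_cons_of_mem_periodPolys {A : Type*} [CommRing A] [Algebra ℚ A]
    {P : evenPolys N (l + 2)} (hP : P ∈ periodPolys N (l + 2)) (a b : A) (F : Fin l → A) :
    aeval (Fin.cons a (Fin.cons b F) : Fin (l + 2) → A) P.1 =
      aeval (Fin.cons (b - a) (Fin.cons b F) : Fin (l + 2) → A) P.1 -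
        aeval (Fin.cons (b - a) (Fin.cons a F) : Fin (l + 2) → A) P.1 := by
  have hsubst (j : ℕ) : (aeval (Fin.cons a (Fin.cons b F) : Fin (l + 2) → A))
      (aeval (periodArg (l + 2) j) P.1) = aeval (Fin.cons (b - a) (Fin.cons
        (aeval (Fin.cons a (Fin.cons b F) : Fin (l + 2) → A) (polyVar (l + 2) j)) F) :
          Fin (l + 2) → A) P.1 := by
    rw [comp_aeval_apply, periodArg_eq_cons]
    congr 2
    funext i
    cases i using Fin.cases with
    | zero => simp [polyVar]
    | succ i =>
      cases i using Fin.cases with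
      | zero => rfl
      | succ i => simp
  have hrel : P.1 = aeval (periodArg (l + 2) 2) P.1 - aeval (periodArg (l + 2) 1) P.1 := hP
  conv_lhs => rw [hrel, map_sub, hsubst, hsubst]
  simp [polyVar]

lemma aeval_cons_cons_swap_of_mem_periodPolys {A : Type*} [CommRing A] [Algebra ℚ A]
    {P : evenPolys N (l + 2)} (hP : P ∈ periodPolys N (l + 2)) (a b : A) (F : Fin l → A) :
    aeval (Fin.cons a (Fin.cons b F) : Fin (l + 2) → A) P.1 =
      -aeval (Fin.cons b (Fin.cons a F) : Fin (l + 2) → A) P.1 := by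
  have hneg (c : A) : aeval (Fin.cons (a - b) (Fin.cons c F) : Fin (l + 2) → A) P.1 =
      aeval (Fin.cons (b - a) (Fin.cons c F) : Fin (l + 2) → A) P.1 :=
    aeval_evenPolys_congr P <| Fin.cases (Or.inr (neg_sub b a).symm) fun _ => Or.inl rfl
  rw [aeval_cons_cons_of_mem_periodPolys hP a b, aeval_cons_cons_of_mem_periodPolys hP b a,
    neg_sub, hneg, hneg]

lemma phiArg_self_eq_cons (l i p : ℕ) :
    (fun k : Fin (l + 1) => phiArg (l + 1) (l + 1) i p (k.val + 1)) =
      Fin.cons (polyVar (l + 1) (i + 1) - polyVar (l + 1) i)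
        fun k : Fin l => omitVar (l + 1) p (k.val + 1) := by
  funext k
  cases k using Fin.cases with
  | zero => simp [phiArg]
  | succ k => simp [phiArg]

lemma phiArg_pred_eq_cons_cons (l i p : ℕ) :
    (fun k : Fin (l + 2) => phiArg (l + 2) (l + 1) i p (k.val + 1)) =
      Fin.cons (polyVar (l + 2) 1) (Fin.cons (polyVar (l + 2) (i + 1) - polyVar (l + 2) i)
        fun k : Fin l => omitVar (l + 2) p (k.val + 2)) := by
  funext k
  cases k using Fin.cases with
  | zero => simp [phiArg]
  | succ k =>
    cases k using Fin.cases with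
    | zero => simp [phiArg]
    | succ k => simp [phiArg]

lemma aeval_phiArg_self_eq_neg {P : evenPolys N (l + 2)} (hP : P ∈ periodPolys N (l + 2)) (i : ℕ)
    {p : ℕ} (hp : 2 ≤ p) :
    aeval (fun k : Fin (l + 2) => phiArg (l + 2) (l + 2) i p (k.val + 1)) P.1 =
      -aeval (fun k : Fin (l + 2) => phiArg (l + 2) (l + 1) i p (k.val + 1)) P.1 := by
  have homit : (fun k : Fin (l + 1) => omitVar (l + 2) p (k.val + 1)) =
      Fin.cons (polyVar (l + 2) 1) fun k : Fin l => omitVar (l + 2) p (k.val + 2) := by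
    funext k
    cases k using Fin.cases with
    | zero => exact if_pos hp
    | succ k => rfl
  rw [phiArg_self_eq_cons, phiArg_pred_eq_cons_cons, homit,
    aeval_cons_cons_swap_of_mem_periodPolys hP]

lemma phiPoly_self_sub_self {P : evenPolys N (l + 2)} (hP : P ∈ periodPolys N (l + 2)) :
    phiPoly (l + 2) (l + 2) P.1 - P.1 = -phiPoly (l + 2) (l + 1) P.1 := by
  have hfirst (p : ℕ) (hp : p = 1 ∨ p = 2) :
      (fun k : Fin (l + 2) => phiArg (l + 2) (l + 2) 1 p (k.val + 1)) =
        periodArg (l + 2) (3 - p) := by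
    rw [phiArg_self_eq_cons, periodArg_eq_cons]
    congr 1
    funext k
    rcases hp with rfl | rfl <;> cases k using Fin.cases <;> simp [omitVar, ← polyVar_succ]
  have hrel : P.1 = aeval (periodArg (l + 2) 2) P.1 - aeval (periodArg (l + 2) 1) P.1 := hP
  have hrest : ∀ i ∈ Finset.Ico 2 (l + 2),
      aeval (fun k : Fin (l + 2) => phiArg (l + 2) (l + 2) i (i + 1) (k.val + 1)) P.1 -
        aeval (fun k : Fin (l + 2) => phiArg (l + 2) (l + 2) i i (k.val + 1)) P.1 =
      -(aeval (fun k : Fin (l + 2) => phiArg (l + 2) (l + 1) i (i + 1) (k.val + 1)) P.1 -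
        aeval (fun k : Fin (l + 2) => phiArg (l + 2) (l + 1) i i (k.val + 1)) P.1) := by
    intro i hi
    have h2 : 2 ≤ i := (Finset.mem_Ico.1 hi).1
    rw [aeval_phiArg_self_eq_neg hP i h2, aeval_phiArg_self_eq_neg hP i (by omega)]
    ring
  simp only [phiPoly, LinearMap.add_apply, LinearMap.id_apply, LinearMap.sum_apply,
    LinearMap.sub_apply, AlgHom.toLinearMap_apply]
  rw [Nat.sub_self, zero_add, show l + 2 - (l + 1) + 1 = 2 by omega,
    Finset.sum_eq_sum_Ico_succ_bot (by omega), Finset.sum_congr rfl hrest, Finset.sum_neg_distrib,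
    hfirst _ (.inr rfl), hfirst _ (.inl rfl)]
  linear_combination hrel

lemma tasakaMap_eq_neg_phi (P : periodPolys N (l + 2)) :
    tasakaMap N (l + 2) P = -(evenMonomials N (l + 2)).equivFun (phi N (l + 2) (l + 1) P.1) := by
  have hphi : tasakaMap N (l + 2) P = (evenMonomials N (l + 2)).equivFun
      (phi N (l + 2) (l + 2) P.1) - (evenMonomials N (l + 2)).equivFun P.1 := by
    rw [evenMonomials_equivFun_phi_eq_vecMul (by omega) le_rfl, matEj_self]
    have hvec : coeffVector N (l + 2) P.1 = (evenMonomials N (l + 2)).equivFun P.1 :=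
      funext fun n => (evenMonomials_equivFun_apply P.1 n).symm
    rw [← hvec, tasakaMap, LinearMap.comp_apply, LinearMap.comp_apply, Submodule.subtype_apply,
      Matrix.vecMulLinear_apply, Matrix.vecMul_sub, Matrix.vecMul_one]
  rw [hphi]
  funext n
  rw [Pi.sub_apply, Pi.neg_apply, evenMonomials_equivFun_phi, evenMonomials_equivFun_phi,
    evenMonomials_equivFun_apply, ← coeff_sub, phiPoly_self_sub_self P.2, coeff_neg]

lemma finrank_map_phi_of_le_periodPolys (h_inj : Function.Injective (tasakaMap N (l + 2)))
    {U : Submodule ℚ (evenPolys N (l + 2))} (hU : U ≤ periodPolys N (l + 2)) :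
    Module.finrank ℚ (U.map (phi N (l + 2) (l + 1))) = Module.finrank ℚ U := by
  rw [← LinearMap.range_domRestrict]
  refine LinearMap.finrank_range_of_inj ((injective_iff_map_eq_zero _).2 fun P hP => ?_)
  have hphi : phi N (l + 2) (l + 1) P.1 = 0 := hP
  have hzero : tasakaMap N (l + 2) ⟨P.1, hU P.2⟩ = 0 := by
    rw [tasakaMap_eq_neg_phi, hphi, map_zero, neg_zero]
  have hP₀ : P.1 = 0 := congrArg Subtype.val ((injective_iff_map_eq_zero _).1 h_inj _ hzero)
  exact Subtype.ext hP₀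

end FactorizationOfTasakaMap

section BinaryForms

open MvPolynomial

lemma eval_pair {R : Type*} [CommSemiring R] (a b : R) (p : MvPolynomial (Fin 2) R) :
    eval ![a, b] p = ∑ d ∈ p.support, coeff d p * (a ^ d 0 * b ^ d 1) := by
  simp [eval_eq']

lemma funext_pair {R : Type*} [CommRing R] [IsDomain R] [Infinite R]
    {p q : MvPolynomial (Fin 2) R} (h : ∀ a b, eval ![a, b] p = eval ![a, b] q) : p = q := by
  refine MvPolynomial.funext fun z => ?_
  rw [show z = ![z 0, z 1] from List.ofFn_inj.1 rfl]
  exact h _ _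

lemma eval_neg_left_of_odd {R : Type*} [CommRing R] {p : MvPolynomial (Fin 2) R}
    (h : ∀ d ∈ p.support, Odd (d 0)) (a b : R) : eval ![-a, b] p = -eval ![a, b] p := by
  rw [eval_pair, eval_pair, ← Finset.sum_neg_distrib]
  exact Finset.sum_congr rfl fun d hd => by rw [(h d hd).neg_pow]; ring

lemma add_eq_of_mem_support_of_isHomogeneous {R : Type*} [CommSemiring R]
    {p : MvPolynomial (Fin 2) R} {n : ℕ} (hp : p.IsHomogeneous n) {d : Fin 2 →₀ ℕ}
    (hd : d ∈ p.support) : d 0 + d 1 = n := by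
  by_contra hne
  refine mem_support_iff.1 hd (hp.coeff_eq_zero ?_)
  rwa [Finsupp.degree_eq_sum, Fin.sum_univ_two]

lemma eval_neg_neg {R : Type*} [CommRing R] {p : MvPolynomial (Fin 2) R} {n : ℕ}
    (hp : p.IsHomogeneous n) (hn : Even n) (a b : R) : eval ![-a, -b] p = eval ![a, b] p := by
  rw [eval_pair, eval_pair]
  refine Finset.sum_congr rfl fun d hd => ?_
  have hsign : (-1 : R) ^ d 0 * (-1) ^ d 1 = 1 := by
    rw [← pow_add, add_eq_of_mem_support_of_isHomogeneous hp hd, hn.neg_one_pow]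
  rw [neg_pow a, neg_pow b, mul_mul_mul_comm, hsign, one_mul]

-- Euclid's algorithm reduces the value at any pair of natural numbers to a value at `(0, b)`.
lemma eq_zero_of_eval_translate {R : Type*} [CommRing R] [IsDomain R] [CharZero R]
    {p : MvPolynomial (Fin 2) R} (h_swap : ∀ a b, eval ![b, a] p = -eval ![a, b] p)
    (h_zero : ∀ b, eval ![0, b] p = 0)
    (h_translate : ∀ a b, eval ![a + b, b] p = eval ![a, b] p) : p = 0 := by
  have h_nat (s m n : ℕ) (hs : m + n = s) : eval ![(m : R), (n : R)] p = 0 := by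
    induction s using Nat.strong_induction_on generalizing m n with
    | _ s ih =>
      rcases Nat.eq_zero_or_pos m with rfl | hm
      · simpa using h_zero n
      rcases Nat.eq_zero_or_pos n with rfl | hn
      · rw [h_swap, Nat.cast_zero, h_zero, neg_zero]
      rcases le_total n m with hle | hle
      · obtain ⟨k, rfl⟩ := Nat.exists_eq_add_of_le' hle
        rw [Nat.cast_add, h_translate, ih _ (by omega) k n rfl]
      · obtain ⟨k, rfl⟩ := Nat.exists_eq_add_of_le' hle
        rw [h_swap, Nat.cast_add, h_translate, ih _ (by omega) k m rfl, neg_zero]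
  refine funext_set (fun _ => Set.range ((↑) : ℕ → R))
    (fun _ => Set.infinite_range_of_injective Nat.cast_injective) fun z hz => ?_
  obtain ⟨m, hm⟩ := hz 0 trivial
  obtain ⟨n, hn⟩ := hz 1 trivial
  rw [show z = ![(m : R), (n : R)] from List.ofFn_inj.1 (by simp [hm, hn]), h_nat _ m n rfl,
    map_zero]

/-- The exponent vector of `x ^ a * y ^ b`. -/
noncomputable def exponentPair (a b : ℕ) : Fin 2 →₀ ℕ := Finsupp.equivFunOnFinite.symm ![a, b]

lemma exponentPair_zero (a b : ℕ) : exponentPair a b 0 = a := rfl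

lemma exponentPair_one (a b : ℕ) : exponentPair a b 1 = b := rfl

lemma exponentPair_eta (d : Fin 2 →₀ ℕ) : exponentPair (d 0) (d 1) = d := by
  ext i
  fin_cases i <;> rfl

lemma exponentPair_inj {a b c d : ℕ} : exponentPair a b = exponentPair c d ↔ a = c ∧ b = d :=
  ⟨fun h => ⟨DFunLike.congr_fun h 0, DFunLike.congr_fun h 1⟩, by rintro ⟨rfl, rfl⟩; rfl⟩

lemma degree_exponentPair (a b : ℕ) : (exponentPair a b).degree = a + b := by
  rw [Finsupp.degree_eq_sum, Fin.sum_univ_two, exponentPair_zero, exponentPair_one]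

lemma monomial_exponentPair {R : Type*} [CommSemiring R] (a b : ℕ) (c : R) :
    monomial (exponentPair a b) c = C c * (X 0 ^ a * X 1 ^ b) := by
  rw [monomial_eq, Finsupp.prod_fintype _ _ (by simp), Fin.prod_univ_two, exponentPair_zero,
    exponentPair_one]

section Dehomogenization

variable {R : Type*} [CommSemiring R]

/-- The polynomial `p(1, y)` in one variable. A binary form is recovered from it and its degree. -/
noncomputable def dehomogenize : MvPolynomial (Fin 2) R →ₐ[R] R[X] :=
  aeval ![1, Polynomial.X]

lemma eval_dehomogenize (p : MvPolynomial (Fin 2) R) (b : R) :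
    (dehomogenize p).eval b = eval ![1, b] p := by
  rw [dehomogenize, ← Polynomial.coe_aeval_eq_eval, comp_aeval_apply, ← aeval_eq_eval]
  congr 2
  funext i
  fin_cases i <;> simp

lemma coeff_dehomogenize (p : MvPolynomial (Fin 2) R) (b : ℕ) :
    (dehomogenize p).coeff b = ∑ d ∈ p.support, if b = d 1 then coeff d p else 0 := by
  rw [dehomogenize, aeval_def, eval₂_eq', Polynomial.finsetSum_coeff]
  simp [Polynomial.coeff_X_pow]

lemma coeff_dehomogenize_of_isHomogeneous {p : MvPolynomial (Fin 2) R} {a b : ℕ}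
    (hp : p.IsHomogeneous (a + b)) :
    (dehomogenize p).coeff b = coeff (exponentPair a b) p := by
  rw [coeff_dehomogenize, Finset.sum_eq_single (exponentPair a b)]
  · rw [exponentPair_one, if_pos rfl]
  · intro d hd hne
    refine if_neg fun hb => hne ?_
    have hdeg := add_eq_of_mem_support_of_isHomogeneous hp hd
    rw [← exponentPair_eta d, exponentPair_inj]
    omega
  · intro h
    rw [notMem_support_iff.1 h, ite_self]

lemma natDegree_dehomogenize_le {p : MvPolynomial (Fin 2) R} {n : ℕ} (hp : p.IsHomogeneous n) :
    (dehomogenize p).natDegree ≤ n := by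
  refine Polynomial.natDegree_le_iff_coeff_eq_zero.2 fun b hb => ?_
  rw [coeff_dehomogenize]
  refine Finset.sum_eq_zero fun d hd => if_neg ?_
  have := add_eq_of_mem_support_of_isHomogeneous hp hd
  omega

lemma eq_zero_of_dehomogenize_eq_zero {p : MvPolynomial (Fin 2) R} {n : ℕ}
    (hp : p.IsHomogeneous n) (h : dehomogenize p = 0) : p = 0 := by
  ext d
  by_cases hd : d.degree = n
  · rw [Finsupp.degree_eq_sum, Fin.sum_univ_two] at hd
    rw [← exponentPair_eta d, ← coeff_dehomogenize_of_isHomogeneous (hd ▸ hp), h]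
    simp
  · rw [hp.coeff_eq_zero hd, coeff_zero]

end Dehomogenization

section Substitutions

variable {R : Type*} [CommRing R]

/-- The substitution `p(x, y) ↦ p(y, x)`. -/
noncomputable def swapVars : MvPolynomial (Fin 2) R →ₐ[R] MvPolynomial (Fin 2) R :=
  aeval ![X 1, X 0]

/-- The substitution `p(x, y) ↦ p(x - y, x)`, of order three on forms of even degree. -/
noncomputable def rotVars : MvPolynomial (Fin 2) R →ₐ[R] MvPolynomial (Fin 2) R :=
  aeval ![X 0 - X 1, X 0]

lemma eval_aeval_pair (a b : R) (f g p : MvPolynomial (Fin 2) R) :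
    eval ![a, b] (aeval ![f, g] p) = eval ![eval ![a, b] f, eval ![a, b] g] p := by
  rw [← aeval_eq_eval, comp_aeval_apply, ← aeval_eq_eval]
  congr 2
  funext i
  fin_cases i <;> rfl

lemma eval_swapVars (a b : R) (p : MvPolynomial (Fin 2) R) :
    eval ![a, b] (swapVars p) = eval ![b, a] p := by
  rw [swapVars, eval_aeval_pair]
  simp

lemma eval_rotVars (a b : R) (p : MvPolynomial (Fin 2) R) :
    eval ![a, b] (rotVars p) = eval ![a - b, a] p := by
  rw [rotVars, eval_aeval_pair]
  simp

lemma swapVars_X_pow_mul_X_pow (a b : ℕ) :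
    swapVars (X 0 ^ a * X 1 ^ b : MvPolynomial (Fin 2) R) = X 0 ^ b * X 1 ^ a := by
  simp [swapVars, mul_comm]

lemma coeff_swapVars (p : MvPolynomial (Fin 2) R) (a b : ℕ) :
    coeff (exponentPair a b) (swapVars p) = coeff (exponentPair b a) p := by
  classical
  induction p using MvPolynomial.induction_on' with
  | add p q hp hq => rw [map_add, coeff_add, coeff_add, hp, hq]
  | monomial d c =>
    rw [← exponentPair_eta d, monomial_exponentPair, map_mul, swapVars_X_pow_mul_X_pow, algHom_C,
      algebraMap_eq, ← monomial_exponentPair, ← monomial_exponentPair, coeff_monomial,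
      coeff_monomial]
    simp only [exponentPair_inj, and_comm]

lemma isHomogeneous_swapVars {n : ℕ} {p : MvPolynomial (Fin 2) R} (hp : p.IsHomogeneous n) :
    (swapVars p).IsHomogeneous n := by
  simpa only [swapVars, one_mul] using hp.aeval (n := 1) ![X 1, X 0]
    (by simp [Fin.forall_fin_two, isHomogeneous_X])

lemma isHomogeneous_rotVars {n : ℕ} {p : MvPolynomial (Fin 2) R} (hp : p.IsHomogeneous n) :
    (rotVars p).IsHomogeneous n := by
  simpa only [rotVars, one_mul] using hp.aeval (n := 1) ![X 0 - X 1, X 0]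
    (by simp [Fin.forall_fin_two, isHomogeneous_X, (isHomogeneous_X _ _).sub])

variable [IsDomain R] [Infinite R]

lemma swapVars_swapVars (p : MvPolynomial (Fin 2) R) : swapVars (swapVars p) = p :=
  funext_pair fun a b => by rw [eval_swapVars, eval_swapVars]

lemma rotVars_rotVars_rotVars {n : ℕ} {p : MvPolynomial (Fin 2) R} (hp : p.IsHomogeneous n)
    (hn : Even n) : rotVars (rotVars (rotVars p)) = p := by
  refine funext_pair fun a b => ?_
  rw [eval_rotVars, eval_rotVars, eval_rotVars, ← eval_neg_neg hp hn a b]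
  ring_nf

lemma swapVars_rotVars {n : ℕ} {p : MvPolynomial (Fin 2) R} (hp : p.IsHomogeneous n)
    (hn : Even n) : swapVars (rotVars p) = rotVars (rotVars (swapVars p)) := by
  refine funext_pair fun a b => ?_
  rw [eval_swapVars, eval_rotVars, eval_rotVars, eval_rotVars, eval_swapVars,
    ← eval_neg_neg hp hn]
  ring_nf

end Substitutions

end BinaryForms

section AlternatingInvariants

open MvPolynomial

variable {K : Type*} [Field K] {n : ℕ}

/-- The space of binary forms of degree `n` that change sign under `(x, y) ↦ (y, x)` and are
invariant under `(x, y) ↦ (x - y, x)`; for even `n` these substitutions generate an action of the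
symmetric group on three letters. -/
noncomputable def alternatingInvariants (K : Type*) [Field K] (n : ℕ) :
    Submodule K (MvPolynomial (Fin 2) K) :=
  homogeneousSubmodule (Fin 2) K n ⊓
    (LinearMap.ker (swapVars.toLinearMap + 1) ⊓ LinearMap.ker (rotVars.toLinearMap - 1))

lemma mem_alternatingInvariants {Q : MvPolynomial (Fin 2) K} :
    Q ∈ alternatingInvariants K n ↔ Q.IsHomogeneous n ∧ swapVars Q = -Q ∧ rotVars Q = Q := by
  simp [alternatingInvariants, add_eq_zero_iff_eq_neg, sub_eq_zero]

instance : FiniteDimensional K (alternatingInvariants K n) := by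
  have : FiniteDimensional K (homogeneousSubmodule (Fin 2) K n) :=
    Module.Finite.of_fg (homogeneousSubmodule_fg _ _ n)
  exact Submodule.finiteDimensional_of_le (inf_le_left : alternatingInvariants K n ≤ _)

lemma eval_swap_of_swapVars_eq_neg {Q : MvPolynomial (Fin 2) K} (h : swapVars Q = -Q) (a b : K) :
    eval ![b, a] Q = -eval ![a, b] Q := by
  rw [← eval_swapVars, h, map_neg]

lemma coeff_swap_of_swapVars_eq_neg {Q : MvPolynomial (Fin 2) K} (h : swapVars Q = -Q)
    (a b : ℕ) : coeff (exponentPair b a) Q = -coeff (exponentPair a b) Q := by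
  rw [← coeff_swapVars, h, coeff_neg]

lemma eval_sub_left_of_rotVars_eq {Q : MvPolynomial (Fin 2) K} (h : rotVars Q = Q) (a b : K) :
    eval ![a - b, a] Q = eval ![a, b] Q := by
  rw [← eval_rotVars, h]

section CharZero

variable [CharZero K]

lemma eval_self_self_of_swapVars_eq_neg {Q : MvPolynomial (Fin 2) K} (h : swapVars Q = -Q)
    (a : K) : eval ![a, a] Q = 0 :=
  self_eq_neg.1 (eval_swap_of_swapVars_eq_neg h a a)

lemma eval_zero_left_of_mem_alternatingInvariants {Q : MvPolynomial (Fin 2) K}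
    (hQ : Q ∈ alternatingInvariants K n) (b : K) : eval ![0, b] Q = 0 := by
  obtain ⟨-, h_swap, h_rot⟩ := mem_alternatingInvariants.1 hQ
  rw [show ![0, b] = ![b - b, b] by rw [sub_self], eval_sub_left_of_rotVars_eq h_rot,
    eval_self_self_of_swapVars_eq_neg h_swap]

lemma coeff_exponentPair_zero_right_of_mem_alternatingInvariants {Q : MvPolynomial (Fin 2) K}
    (hQ : Q ∈ alternatingInvariants K n) (a : ℕ) : coeff (exponentPair a 0) Q = 0 := by
  obtain ⟨h_hom, h_swap, -⟩ := mem_alternatingInvariants.1 hQ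
  rcases eq_or_ne a n with rfl | ha
  · rw [← coeff_dehomogenize_of_isHomogeneous h_hom, Polynomial.coeff_zero_eq_eval_zero,
      eval_dehomogenize, eval_swap_of_swapVars_eq_neg h_swap,
      eval_zero_left_of_mem_alternatingInvariants hQ, neg_zero]
  · exact h_hom.coeff_eq_zero (by rwa [degree_exponentPair])

-- All exponents of `x` that occur are odd, so `Q(-x, y) = -Q(x, y)`. Together with the two
-- symmetries this makes `Q` invariant under `(x, y) ↦ (x + y, y)`.
lemma eq_zero_of_forall_even_coeff_eq_zero {Q : MvPolynomial (Fin 2) K}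
    (hQ : Q ∈ alternatingInvariants K n) (hn : Even n)
    (h_even : ∀ d : Fin 2 →₀ ℕ, (∀ i, Even (d i) ∧ 2 ≤ d i) → coeff d Q = 0) : Q = 0 := by
  obtain ⟨h_hom, h_swap, h_rot⟩ := mem_alternatingInvariants.1 hQ
  have h_odd (d) (hd : d ∈ Q.support) : Odd (d 0) := by
    by_contra hd0
    rw [Nat.not_odd_iff_even] at hd0
    have hd1 : Even (d 1) := by
      rwa [← add_eq_of_mem_support_of_isHomogeneous h_hom hd, Nat.even_add, iff_true_left hd0]
        at hn
    refine mem_support_iff.1 hd ?_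
    have h_right (a : ℕ) := coeff_exponentPair_zero_right_of_mem_alternatingInvariants hQ a
    rcases Nat.eq_zero_or_pos (d 0) with h0 | h0
    · rw [← exponentPair_eta d, h0, coeff_swap_of_swapVars_eq_neg h_swap, h_right, neg_zero]
    rcases Nat.eq_zero_or_pos (d 1) with h1 | h1
    · rw [← exponentPair_eta d, h1, h_right]
    refine h_even d (Fin.forall_fin_two.2 ⟨⟨hd0, ?_⟩, hd1, ?_⟩)
    · exact Nat.le_of_dvd h0 hd0.two_dvd
    · exact Nat.le_of_dvd h1 hd1.two_dvd
  refine eq_zero_of_eval_translate (eval_swap_of_swapVars_eq_neg h_swap)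
    (eval_zero_left_of_mem_alternatingInvariants hQ) fun a b => ?_
  calc eval ![a + b, b] Q = eval ![b - -a, b] Q := by rw [sub_neg_eq_add, add_comm]
    _ = eval ![b, -a] Q := eval_sub_left_of_rotVars_eq h_rot b (-a)
    _ = -eval ![-a, b] Q := eval_swap_of_swapVars_eq_neg h_swap _ _
    _ = eval ![a, b] Q := by rw [eval_neg_left_of_odd h_odd, neg_neg]

end CharZero

section Apolarity

open Finset.HasAntidiagonal (antidiagonal mem_antidiagonal)

/-- The form of degree `n` corresponding to a linear functional under the apolarity pairing: its
value at `(s, t)` is the value of the functional at `(s x - t y) ^ n`. -/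
noncomputable def apolarForm (n : ℕ) (μ : MvPolynomial (Fin 2) K →ₗ[K] K) :
    MvPolynomial (Fin 2) K :=
  ∑ p ∈ antidiagonal n, monomial (exponentPair p.1 p.2)
    ((-1) ^ p.2 * n.choose p.1 * μ (monomial (exponentPair p.1 p.2) 1))

lemma isHomogeneous_apolarForm (n : ℕ) (μ : MvPolynomial (Fin 2) K →ₗ[K] K) :
    (apolarForm n μ).IsHomogeneous n :=
  IsHomogeneous.sum _ _ _ fun p hp => isHomogeneous_monomial _ <| by
    rw [degree_exponentPair, mem_antidiagonal.1 hp]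

lemma eval_apolarForm (n : ℕ) (μ : MvPolynomial (Fin 2) K →ₗ[K] K) (s t : K) :
    eval ![s, t] (apolarForm n μ) = μ ((C s * X 0 - C t * X 1) ^ n) := by
  rw [sub_eq_add_neg, (Commute.all _ _).add_pow', map_sum, apolarForm, map_sum]
  refine Finset.sum_congr rfl fun p _ => ?_
  have h_term : n.choose p.1 • ((C s * X 0) ^ p.1 * (-(C t * X 1)) ^ p.2) =
      ((-1) ^ p.2 * n.choose p.1 * (s ^ p.1 * t ^ p.2)) •
        (monomial (exponentPair p.1 p.2) 1 : MvPolynomial (Fin 2) K) := by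
    rw [monomial_exponentPair, neg_pow, mul_pow, mul_pow, nsmul_eq_mul, smul_eq_C_mul]
    simp only [map_mul, map_pow, map_neg, map_one, map_natCast]
    ring
  rw [h_term, map_smul, monomial_exponentPair _ _ (_ * _), smul_eq_mul]
  simp only [map_mul, map_pow, eval_C, eval_X, Matrix.cons_val_zero, Matrix.cons_val_one]
  ring

lemma coeff_apolarForm (μ : MvPolynomial (Fin 2) K →ₗ[K] K) (d : Fin 2 →₀ ℕ) :
    coeff d (apolarForm d.degree μ) = (-1) ^ d 1 * d.degree.choose (d 0) * μ (monomial d 1) := by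
  classical
  rw [apolarForm, coeff_sum, Finset.sum_eq_single (d 0, d 1)]
  · rw [exponentPair_eta, coeff_monomial, if_pos rfl]
  · intro p _ hne
    rw [coeff_monomial, if_neg]
    rintro rfl
    exact hne rfl
  · intro hd
    rw [mem_antidiagonal, Finsupp.degree_eq_sum, Fin.sum_univ_two] at hd
    exact absurd rfl hd

variable [CharZero K]

lemma apolarForm_mem_alternatingInvariants (hn : Even n) {μ : MvPolynomial (Fin 2) K →ₗ[K] K}
    (h_swap : ∀ p : MvPolynomial (Fin 2) K, p.IsHomogeneous n → μ (swapVars p) = -μ p)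
    (h_rot : ∀ p : MvPolynomial (Fin 2) K, p.IsHomogeneous n → μ (rotVars p) = μ p) :
    apolarForm n μ ∈ alternatingInvariants K n := by
  have h_hom (s t : K) :
      ((C s * X 0 - C t * X 1) ^ n : MvPolynomial (Fin 2) K).IsHomogeneous n := by
    simpa only [one_mul] using
      ((isHomogeneous_C_mul_X s 0).sub (isHomogeneous_C_mul_X t 1)).pow n
  refine mem_alternatingInvariants.2 ⟨isHomogeneous_apolarForm n μ, ?_, ?_⟩
  · refine funext_pair fun s t => ?_
    have h_line : swapVars ((C s * X 0 - C t * X 1) ^ n) =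
        ((C t * X 0 - C s * X 1) ^ n : MvPolynomial (Fin 2) K) := by
      rw [← hn.neg_pow]
      simp [swapVars]
    rw [eval_swapVars, map_neg, eval_apolarForm, eval_apolarForm, ← h_swap _ (h_hom s t), h_line]
  · refine funext_pair fun s t => ?_
    have h_line : rotVars ((C s * X 0 - C t * X 1) ^ n) =
        ((C (s - t) * X 0 - C s * X 1) ^ n : MvPolynomial (Fin 2) K) := by
      simp only [rotVars, map_pow, map_sub, map_mul, algHom_C, algebraMap_eq, aeval_X,
        Matrix.cons_val_zero, Matrix.cons_val_one]
      ring
    rw [eval_rotVars, eval_apolarForm, eval_apolarForm, ← h_rot _ (h_hom s t), h_line]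

lemma map_eq_zero_of_forall_even_monomial_eq_zero (hn : Even n)
    {μ : MvPolynomial (Fin 2) K →ₗ[K] K}
    (h_swap : ∀ p : MvPolynomial (Fin 2) K, p.IsHomogeneous n → μ (swapVars p) = -μ p)
    (h_rot : ∀ p : MvPolynomial (Fin 2) K, p.IsHomogeneous n → μ (rotVars p) = μ p)
    (h_even : ∀ d : Fin 2 →₀ ℕ, d.degree = n → (∀ i, Even (d i) ∧ 2 ≤ d i) →
      μ (monomial d 1) = 0)
    {p : MvPolynomial (Fin 2) K} (hp : p.IsHomogeneous n) : μ p = 0 := by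
  have h_apolar : apolarForm n μ = 0 := by
    refine eq_zero_of_forall_even_coeff_eq_zero
      (apolarForm_mem_alternatingInvariants hn h_swap h_rot) hn fun d hd => ?_
    by_cases hdeg : d.degree = n
    · rw [← hdeg, coeff_apolarForm, h_even d hdeg hd, mul_zero]
    · exact (isHomogeneous_apolarForm n μ).coeff_eq_zero hdeg
  rw [p.as_sum, map_sum]
  refine Finset.sum_eq_zero fun d hd => ?_
  have hdeg : d 0 + d 1 = n := add_eq_of_mem_support_of_isHomogeneous hp hd
  obtain rfl : d.degree = n := by rwa [Finsupp.degree_eq_sum, Fin.sum_univ_two]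
  have h_coeff := coeff_apolarForm μ d
  have h_choose : (d.degree.choose (d 0) : K) ≠ 0 :=
    Nat.cast_ne_zero.2 (Nat.choose_pos (by omega)).ne'
  rw [h_apolar, coeff_zero, eq_comm, mul_eq_zero, or_iff_right (by simp [h_choose])] at h_coeff
  rw [← mul_one (coeff d p), ← smul_eq_mul, ← smul_monomial, map_smul, h_coeff, smul_zero]

end Apolarity

end AlternatingInvariants

section EvenPeriodPolynomialsInTwoVariables

open MvPolynomial

section RotationSum

variable {K : Type*} [Field K] {n : ℕ}

/-- The sum of the iterates of the substitution `rotVars`, which on forms of even degree is the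
projection to its fixed points up to the factor three. -/
noncomputable def rotSum : MvPolynomial (Fin 2) K →ₗ[K] MvPolynomial (Fin 2) K :=
  LinearMap.id + rotVars.toLinearMap + rotVars.toLinearMap ∘ₗ rotVars.toLinearMap

lemma rotSum_apply (p : MvPolynomial (Fin 2) K) :
    rotSum p = p + rotVars p + rotVars (rotVars p) := rfl

lemma rotSum_of_rotVars_eq {p : MvPolynomial (Fin 2) K} (h : rotVars p = p) :
    rotSum p = (3 : K) • p := by
  rw [rotSum_apply, h, h]
  module

variable [CharZero K]

lemma rotSum_rotVars {p : MvPolynomial (Fin 2) K} (hp : p.IsHomogeneous n) (hn : Even n) :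
    rotSum (rotVars p) = rotSum p := by
  rw [rotSum_apply, rotSum_apply, rotVars_rotVars_rotVars hp hn]
  ring

lemma rotSum_mem_alternatingInvariants {p : MvPolynomial (Fin 2) K} (hp : p.IsHomogeneous n)
    (hn : Even n) (h_swap : swapVars p = -p) : rotSum p ∈ alternatingInvariants K n := by
  have hp' := isHomogeneous_rotVars hp
  refine mem_alternatingInvariants.2 ⟨(hp.add hp').add (isHomogeneous_rotVars hp'), ?_, ?_⟩
  · rw [rotSum_apply, map_add, map_add, swapVars_rotVars hp' hn, swapVars_rotVars hp hn, h_swap]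
    simp only [map_neg, rotVars_rotVars_rotVars hp' hn]
    ring
  · simp only [rotSum_apply, map_add, rotVars_rotVars_rotVars hp hn]
    ring

lemma rotSum_swapVars_rotVars {p : MvPolynomial (Fin 2) K} (hp : p.IsHomogeneous n)
    (hn : Even n) : rotSum (swapVars (rotVars p)) = rotSum (swapVars p) := by
  have h := isHomogeneous_swapVars hp
  rw [swapVars_rotVars hp hn, rotSum_rotVars (isHomogeneous_rotVars h) hn, rotSum_rotVars h hn]

end RotationSum

variable {N : ℕ}

lemma even_and_four_le (m : OddIdx N 2) : Even N ∧ 4 ≤ N := by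
  obtain ⟨h_sum, h_odd⟩ := mem_oddIndices.1 m.2
  rw [Fin.sum_univ_two] at h_sum
  have h0 := (h_odd 0).1
  have h1 := (h_odd 1).1
  exact ⟨h_sum ▸ (h_odd 0).2.add_odd (h_odd 1).2, by omega⟩

lemma exists_shiftedExponent_eq_iff {r : ℕ} {d : Fin r →₀ ℕ} :
    (∃ m : OddIdx N r, shiftedExponent m.1 = d) ↔
      d.degree + r = N ∧ ∀ i, Even (d i) ∧ 2 ≤ d i := by
  constructor
  · rintro ⟨m, rfl⟩
    refine ⟨?_, shiftedExponent_even_and_two_le m⟩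
    obtain ⟨h_sum, h_odd⟩ := mem_oddIndices.1 m.2
    calc (shiftedExponent m.1).degree + r = ∑ i, (m.1 i - 1) + ∑ _i : Fin r, 1 := by
          simp [Finsupp.degree_eq_sum, shiftedExponent_apply]
      _ = ∑ i, m.1 i := by
          rw [← Finset.sum_add_distrib]
          exact Finset.sum_congr rfl fun i _ => Nat.sub_add_cancel ((h_odd i).1.trans' (by decide))
      _ = N := h_sum
  · rintro ⟨h_degree, h_even⟩
    refine ⟨⟨fun i => d i + 1, mem_oddIndices.2 ⟨?_, fun i => ?_⟩⟩,
      Finsupp.ext fun _ => rfl⟩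
    · rw [Finset.sum_add_distrib, ← Finsupp.degree_eq_sum, ← h_degree]
      simp
    · exact ⟨Nat.succ_le_succ (h_even i).2, (h_even i).1.add_one⟩

lemma isHomogeneous_of_mem_evenPolys {r : ℕ} {P : MvPolynomial (Fin r) ℚ}
    (hP : P ∈ evenPolys N r) : P.IsHomogeneous (N - r) := by
  intro d hd
  obtain ⟨h_degree, -⟩ := exists_shiftedExponent_eq_iff.1 (mem_evenPolys_iff.1 hP d hd)
  exact (congrArg (· d) Finsupp.degree_eq_weight_one).symm.trans (Nat.eq_sub_of_add_eq h_degree)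

lemma swapVars_mem_evenPolys {P : MvPolynomial (Fin 2) ℚ} (hP : P ∈ evenPolys N 2) :
    swapVars P ∈ evenPolys N 2 := by
  refine mem_evenPolys_iff.2 fun d hd => exists_shiftedExponent_eq_iff.2 ?_
  rw [← exponentPair_eta d, coeff_swapVars] at hd
  obtain ⟨h_degree, h_even⟩ := exists_shiftedExponent_eq_iff.1 (mem_evenPolys_iff.1 hP _ hd)
  rw [degree_exponentPair, add_comm (d 1)] at h_degree
  rw [Finsupp.degree_eq_sum, Fin.sum_univ_two]
  exact ⟨h_degree, Fin.forall_fin_two.2 ⟨h_even 1, h_even 0⟩⟩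

/-- The polynomials in `V_{N,2}` that change sign under exchange of the two variables. -/
noncomputable def antisymmPolys (N : ℕ) : Submodule ℚ (evenPolys N 2) :=
  (LinearMap.ker (swapVars.toLinearMap + 1)).comap (evenPolys N 2).subtype

lemma mem_antisymmPolys {P : evenPolys N 2} : P ∈ antisymmPolys N ↔ swapVars P.1 = -P.1 := by
  simp [antisymmPolys, add_eq_zero_iff_eq_neg]

/-- The tuple `(n_r, …, n_1)`. -/
def OddIdx.reverse {r : ℕ} (m : OddIdx N r) : OddIdx N r :=
  ⟨m.1 ∘ Fin.rev, mem_oddIndices.2 ⟨(Equiv.sum_comp Fin.revPerm m.1).trans (mem_oddIndices.1 m.2).1,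
    fun i => (mem_oddIndices.1 m.2).2 i.rev⟩⟩

lemma reverse_reverse {r : ℕ} (m : OddIdx N r) : m.reverse.reverse = m :=
  Subtype.ext (funext fun i => congrArg m.1 i.rev_rev)

lemma shiftedExponent_reverse (m : OddIdx N 2) : shiftedExponent m.reverse.1 =
    exponentPair (shiftedExponent m.1 1) (shiftedExponent m.1 0) := by
  ext i
  fin_cases i <;> rfl

lemma mem_antisymmPolys_iff_forall_coeff {P : evenPolys N 2} : P ∈ antisymmPolys N ↔
    ∀ m : OddIdx N 2,
      coeff (shiftedExponent m.reverse.1) P.1 = -coeff (shiftedExponent m.1) P.1 := by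
  rw [mem_antisymmPolys]
  refine ⟨fun h m => ?_, fun h => ?_⟩
  · rw [shiftedExponent_reverse, coeff_swap_of_swapVars_eq_neg h, exponentPair_eta]
  · ext d
    by_cases hd : ∃ m : OddIdx N 2, shiftedExponent m.1 = d
    · obtain ⟨m, rfl⟩ := hd
      rw [coeff_neg, ← h, shiftedExponent_reverse, ← coeff_swapVars, exponentPair_eta]
    · have h_vanish {Q : MvPolynomial (Fin 2) ℚ} (hQ : Q ∈ evenPolys N 2) : coeff d Q = 0 :=
        by_contra fun h_coeff => hd (mem_evenPolys_iff.1 hQ d h_coeff)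
      rw [coeff_neg, h_vanish P.2, h_vanish (swapVars_mem_evenPolys P.2), neg_zero]

lemma rotSum_mem_alternatingInvariants_of_mem_antisymmPolys (hN : Even N) {P : evenPolys N 2}
    (hP : P ∈ antisymmPolys N) : rotSum P.1 ∈ alternatingInvariants ℚ (N - 2) :=
  rotSum_mem_alternatingInvariants (isHomogeneous_of_mem_evenPolys P.2) (hN.tsub even_two)
    (mem_antisymmPolys.1 hP)

lemma periodDefect_two (P : evenPolys N 2) :
    periodDefect 2 P.1 = P.1 + (rotVars P.1 - swapVars (rotVars P.1)) := by
  have h_one : aeval (periodArg 2 1) P.1 = rotVars P.1 :=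
    aeval_evenPolys_congr P <| Fin.forall_fin_two.2
      ⟨Or.inr (by simp [periodArg, polyVar]), Or.inl (by simp [periodArg, polyVar])⟩
  have h_two : aeval (periodArg 2 2) P.1 = swapVars (rotVars P.1) := by
    rw [rotVars, swapVars, comp_aeval_apply]
    congr 2
    funext i
    fin_cases i <;> simp [periodArg, polyVar]
  rw [periodDefect, LinearMap.sub_apply, LinearMap.sub_apply, LinearMap.id_apply,
    AlgHom.toLinearMap_apply, AlgHom.toLinearMap_apply, h_one, h_two]
  ring

lemma phiPoly_two_two (p : MvPolynomial (Fin 2) ℚ) : phiPoly 2 2 p = periodDefect 2 p := by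
  have h_arg (q : ℕ) (hq : q = 1 ∨ q = 2) :
      (fun k : Fin 2 => phiArg 2 2 1 (3 - q) (k.val + 1)) = periodArg 2 q := by
    funext k
    rcases hq with rfl | rfl <;> fin_cases k <;> simp [phiArg, periodArg, omitVar]
  have h_one := h_arg 1 (Or.inl rfl)
  have h_two := h_arg 2 (Or.inr rfl)
  simp only [Nat.reduceSub] at h_one h_two
  simp only [phiPoly, periodDefect, Nat.sub_self, zero_add, Nat.Ico_succ_singleton,
    Finset.sum_singleton, Nat.reduceAdd, h_one, h_two]
  simp only [LinearMap.add_apply, LinearMap.sub_apply, LinearMap.id_apply]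
  ring

lemma periodDefect_two_eq_rotSum (hN : Even N) {P : evenPolys N 2} (hP : P ∈ antisymmPolys N) :
    periodDefect 2 P.1 = rotSum P.1 := by
  rw [periodDefect_two, swapVars_rotVars (isHomogeneous_of_mem_evenPolys P.2) (hN.tsub even_two),
    mem_antisymmPolys.1 hP, map_neg, map_neg, rotSum_apply]
  ring

lemma swapVars_rotVars_sub_swapVars (p : MvPolynomial (Fin 2) ℚ) :
    swapVars (rotVars p - swapVars (rotVars p)) = -(rotVars p - swapVars (rotVars p)) := by
  rw [map_sub, swapVars_swapVars, neg_sub]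

lemma mem_antisymmPolys_of_totallyEvenPart_periodDefect_eq_zero {P : evenPolys N 2}
    (h : totallyEvenPart 2 (periodDefect 2 P.1) = 0) : P ∈ antisymmPolys N := by
  have h_coeff (m : OddIdx N 2) : coeff (shiftedExponent m.1) P.1 =
      -coeff (shiftedExponent m.1) (rotVars P.1 - swapVars (rotVars P.1)) := by
    rw [eq_neg_iff_add_eq_zero, ← coeff_add, ← periodDefect_two,
      ← coeff_totallyEvenPart _ (shiftedExponent_even_and_two_le m), h, coeff_zero]
  refine mem_antisymmPolys_iff_forall_coeff.2 fun m => ?_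
  rw [h_coeff, h_coeff, shiftedExponent_reverse,
    coeff_swap_of_swapVars_eq_neg (swapVars_rotVars_sub_swapVars P.1), exponentPair_eta]

lemma ker_phi_two : LinearMap.ker (phi N 2 2) = periodPolys N 2 := by
  ext P
  have h_phi : P ∈ LinearMap.ker (phi N 2 2) ↔ totallyEvenPart 2 (periodDefect 2 P.1) = 0 := by
    rw [LinearMap.mem_ker, ← phiPoly_two_two, ← Submodule.coe_eq_zero]
    rfl
  rw [h_phi, mem_periodPolys]
  refine ⟨fun h => ?_, fun h => by rw [h, map_zero]⟩
  by_cases hN : Even N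
  · have hP := mem_antisymmPolys_of_totallyEvenPart_periodDefect_eq_zero h
    rw [periodDefect_two_eq_rotSum hN hP] at h ⊢
    refine eq_zero_of_forall_even_coeff_eq_zero
      (rotSum_mem_alternatingInvariants_of_mem_antisymmPolys hN hP) (hN.tsub even_two)
      fun d hd => ?_
    rw [← coeff_totallyEvenPart _ hd, h, coeff_zero]
  · have : IsEmpty (OddIdx N 2) := ⟨fun m => hN (even_and_four_le m).1⟩
    have : Subsingleton (evenPolys N 2) := (evenMonomials N 2).equivFun.injective.subsingleton
    rw [Subsingleton.elim P 0, Submodule.coe_zero, map_zero]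

lemma mem_periodPolys_two_iff (hN : Even N) {P : evenPolys N 2} :
    P ∈ periodPolys N 2 ↔ P ∈ antisymmPolys N ∧ rotSum P.1 = 0 := by
  constructor
  · intro h
    have h_swap : P ∈ antisymmPolys N :=
      mem_antisymmPolys_of_totallyEvenPart_periodDefect_eq_zero <| by
        rw [mem_periodPolys.1 h, map_zero]
    exact ⟨h_swap, by rw [← periodDefect_two_eq_rotSum hN h_swap, mem_periodPolys.1 h]⟩
  · rintro ⟨h_swap, h_rot⟩
    rw [mem_periodPolys, periodDefect_two_eq_rotSum hN h_swap, h_rot]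

lemma monomial_sub_swapVars_mem_antisymmPolys {d : Fin 2 →₀ ℕ} (h_degree : d.degree + 2 = N)
    (h_even : ∀ i, Even (d i) ∧ 2 ≤ d i) :
    ∃ P ∈ antisymmPolys N, P.1 = monomial d 1 - swapVars (monomial d 1) := by
  have hd : (monomial d 1 : MvPolynomial (Fin 2) ℚ) ∈ evenPolys N 2 := by
    obtain ⟨m, rfl⟩ := exists_shiftedExponent_eq_iff.2 ⟨h_degree, h_even⟩
    exact Submodule.subset_span ⟨m, rfl⟩
  refine ⟨⟨_, Submodule.sub_mem _ hd (swapVars_mem_evenPolys hd)⟩, mem_antisymmPolys.2 ?_, rfl⟩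
  rw [map_sub, swapVars_swapVars, neg_sub]

-- A functional vanishing on the sums over rotations of antisymmetric even polynomials, pulled back
-- along antisymmetrization and summation over rotations, vanishes on all forms by apolarity.
lemma exists_rotSum_eq_of_mem_alternatingInvariants (hN : Even N) (hN2 : 2 ≤ N)
    {Q : MvPolynomial (Fin 2) ℚ} (hQ : Q ∈ alternatingInvariants ℚ (N - 2)) :
    ∃ P ∈ antisymmPolys N, rotSum P.1 = Q := by
  obtain ⟨h_hom, h_swap, h_rot⟩ := mem_alternatingInvariants.1 hQ
  have hn : Even (N - 2) := hN.tsub even_two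
  suffices hmem : Q ∈ (antisymmPolys N).map (rotSum ∘ₗ (evenPolys N 2).subtype) from hmem
  by_contra hmem
  obtain ⟨f, hfQ, hf⟩ := Submodule.exists_le_ker_of_notMem hmem
  let μ := f ∘ₗ rotSum ∘ₗ (LinearMap.id - swapVars.toLinearMap)
  have hμ (p) : μ p = f (rotSum p) - f (rotSum (swapVars p)) := by
    rw [← map_sub, ← map_sub]
    rfl
  have hμQ : μ Q = 0 := by
    refine map_eq_zero_of_forall_even_monomial_eq_zero hn (fun p _ => ?_) (fun p hp => ?_)
      (fun d h_degree h_even => ?_) h_hom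
    · rw [hμ, hμ, swapVars_swapVars, neg_sub]
    · rw [hμ, hμ, rotSum_rotVars hp hn, rotSum_swapVars_rotVars hp hn]
    · obtain ⟨P, hP, hPd⟩ := monomial_sub_swapVars_mem_antisymmPolys
        (N := N) (by rw [h_degree, Nat.sub_add_cancel hN2]) h_even
      have hfP : f (rotSum P.1) = 0 := hf (Submodule.mem_map_of_mem hP)
      rwa [hPd] at hfP
  rw [hμ, h_swap, map_neg, map_neg, sub_neg_eq_add, ← two_mul, rotSum_of_rotVars_eq h_rot,
    map_smul, smul_eq_mul] at hμQ
  exact hfQ (by linarith)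

end EvenPeriodPolynomialsInTwoVariables

section DimensionOfAlternatingInvariants

open MvPolynomial

lemma X_pow_dvd_of_forall_mem_support {σ R : Type*} [CommSemiring R] {i : σ} {k : ℕ}
    {p : MvPolynomial σ R} (h : ∀ d ∈ p.support, k ≤ d i) : X i ^ k ∣ p := by
  rw [X_pow_eq_monomial, ← Ideal.mem_span_singleton,
    ← Set.image_singleton (f := fun d => monomial d (1 : R)), mem_ideal_span_monomial_image]
  exact fun d hd => ⟨_, rfl, Finsupp.single_le_iff.2 (h d hd)⟩

lemma homogeneousComponent_mul_of_isHomogeneous {σ R : Type*} [CommSemiring R]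
    {p : MvPolynomial σ R} {m : ℕ} (hp : p.IsHomogeneous m) (q : MvPolynomial σ R) (n : ℕ) :
    homogeneousComponent (m + n) (p * q) = p * homogeneousComponent n q := by
  let _ := gradedAlgebra (σ := σ) (R := R)
  have h_decompose (r : MvPolynomial σ R) (i : ℕ) :
      (DirectSum.decompose (homogeneousSubmodule σ R) r i : MvPolynomial σ R) =
        homogeneousComponent i r := decomposition.decompose'_apply r i
  simpa only [h_decompose] using
    DirectSum.coe_decompose_mul_add_of_left_mem (homogeneousSubmodule σ R) (b := q) (j := n) hp

lemma isHomogeneous_mul_iff {σ R : Type*} [CommRing R] [IsDomain R] {p q : MvPolynomial σ R}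
    {m n : ℕ} (hp : p.IsHomogeneous m) (hp0 : p ≠ 0) :
    (p * q).IsHomogeneous (m + n) ↔ q.IsHomogeneous n := by
  refine ⟨fun h => ?_, hp.mul⟩
  have h_component := homogeneousComponent_mul_of_isHomogeneous hp q n
  rw [homogeneousComponent_eq_self h] at h_component
  rw [mul_left_cancel₀ hp0 h_component]
  exact homogeneousComponent_isHomogeneous _ _

section Generators

variable (R : Type*) [CommRing R]

/-- The form `(x y (x - y))²`, fixed by `swapVars` and `rotVars`. -/
noncomputable def discrInvariant : MvPolynomial (Fin 2) R :=
  X 1 ^ 2 * (X 0 ^ 2 * (X 0 - X 1) ^ 2)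

/-- The form `x² - x y + y²`, fixed by `swapVars` and `rotVars`. -/
noncomputable def quadInvariant : MvPolynomial (Fin 2) R :=
  X 0 ^ 2 - X 0 * X 1 + X 1 ^ 2

/-- The alternating invariant of least degree. Its linear factors are the lines on which every
alternating invariant of even degree vanishes. -/
noncomputable def altInvariant : MvPolynomial (Fin 2) R :=
  X 1 * (X 0 * (X 0 - X 1) * (X 0 - C 2 * X 1) * (C 2 * X 0 - X 1) * (X 0 + X 1))

variable {R}

lemma swapVars_discrInvariant : swapVars (discrInvariant R) = discrInvariant R := by
  simp only [discrInvariant, swapVars, map_mul, map_pow, map_sub, aeval_X, Matrix.cons_val_zero,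
    Matrix.cons_val_one]
  ring

lemma rotVars_discrInvariant : rotVars (discrInvariant R) = discrInvariant R := by
  simp only [discrInvariant, rotVars, map_mul, map_pow, map_sub, aeval_X, Matrix.cons_val_zero,
    Matrix.cons_val_one]
  ring

lemma isHomogeneous_discrInvariant : (discrInvariant R).IsHomogeneous 6 :=
  (isHomogeneous_X_pow _ _).mul ((isHomogeneous_X_pow _ _).mul
    (((isHomogeneous_X _ _).sub (isHomogeneous_X _ _)).pow 2))

lemma discrInvariant_ne_zero [IsDomain R] : discrInvariant R ≠ 0 :=
  mul_ne_zero (pow_ne_zero 2 (X_ne_zero 1)) <| mul_ne_zero (pow_ne_zero 2 (X_ne_zero 0)) <|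
    pow_ne_zero 2 <| sub_ne_zero.2 <| (X_injective (R := R)).ne zero_ne_one

lemma swapVars_quadInvariant : swapVars (quadInvariant R) = quadInvariant R := by
  simp only [quadInvariant, swapVars, map_mul, map_pow, map_sub, map_add, aeval_X,
    Matrix.cons_val_zero, Matrix.cons_val_one]
  ring

lemma rotVars_quadInvariant : rotVars (quadInvariant R) = quadInvariant R := by
  simp only [quadInvariant, rotVars, map_mul, map_pow, map_sub, map_add, aeval_X,
    Matrix.cons_val_zero, Matrix.cons_val_one]
  ring

lemma isHomogeneous_quadInvariant : (quadInvariant R).IsHomogeneous 2 :=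
  ((isHomogeneous_X_pow _ _).sub ((isHomogeneous_X _ _).mul (isHomogeneous_X _ _))).add
    (isHomogeneous_X_pow _ _)

lemma swapVars_altInvariant : swapVars (altInvariant R) = -altInvariant R := by
  simp only [altInvariant, swapVars, map_mul, map_sub, map_add, aeval_X, algHom_C, algebraMap_eq,
    Matrix.cons_val_zero, Matrix.cons_val_one]
  ring

lemma rotVars_altInvariant : rotVars (altInvariant R) = altInvariant R := by
  simp only [altInvariant, rotVars, map_mul, map_sub, map_add, aeval_X, map_ofNat,
    Matrix.cons_val_zero, Matrix.cons_val_one]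
  ring

lemma isHomogeneous_altInvariant : (altInvariant R).IsHomogeneous 6 := by
  have hX (i : Fin 2) : (X i : MvPolynomial (Fin 2) R).IsHomogeneous 1 := isHomogeneous_X _ _
  exact (hX 1).mul (((((hX 0).mul ((hX 0).sub (hX 1))).mul ((hX 0).sub ((hX 1).C_mul 2))).mul
    (((hX 0).C_mul 2).sub (hX 1))).mul ((hX 0).add (hX 1)))

lemma coeff_one_dehomogenize_discrInvariant_mul (p : MvPolynomial (Fin 2) R) :
    (dehomogenize (discrInvariant R * p)).coeff 1 = 0 := by
  rw [dehomogenize, discrInvariant, mul_assoc, map_mul, map_pow, aeval_X]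
  simp [Polynomial.coeff_X_pow_mul']

lemma coeff_one_dehomogenize_altInvariant_mul (k : ℕ) :
    (dehomogenize (altInvariant R * quadInvariant R ^ k)).coeff 1 = 2 := by
  rw [dehomogenize, altInvariant, mul_assoc, map_mul, aeval_X, Matrix.cons_val_one,
    Matrix.cons_val_fin_one, Polynomial.coeff_X_mul, Polynomial.coeff_zero_eq_eval_zero]
  simp [quadInvariant]

end Generators

variable {K : Type*} [Field K] {n k : ℕ}

lemma discrInvariant_dvd {Q : MvPolynomial (Fin 2) K} (h_swap : swapVars Q = -Q)
    (h_rot : rotVars Q = Q) (h : X 1 ^ 2 ∣ Q) : discrInvariant K ∣ Q := by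
  have h_zero : X 0 ^ 2 ∣ Q := by
    rw [← dvd_neg, ← h_swap]
    simpa only [map_pow, swapVars, aeval_X, Matrix.cons_val_one, Matrix.cons_val_zero,
      Matrix.cons_val_fin_one] using map_dvd swapVars h
  have h_diff : (X 0 - X 1) ^ 2 ∣ Q := by
    rw [← h_rot]
    simpa only [map_pow, rotVars, aeval_X, Matrix.cons_val_zero] using map_dvd rotVars h_zero
  have h_irred (i : Fin 2) : Irreducible (X i : MvPolynomial (Fin 2) K) := X_prime.irreducible
  have h_one_zero : IsRelPrime (X 1 : MvPolynomial (Fin 2) K) (X 0) :=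
    (h_irred 1).isRelPrime_iff_not_dvd.2 (by simp [X_dvd_X])
  have h_one_diff : IsRelPrime (X 1 : MvPolynomial (Fin 2) K) (X 0 - X 1) :=
    (h_irred 1).isRelPrime_iff_not_dvd.2 (by simp [dvd_sub_self_right, X_dvd_X])
  have h_zero_diff : IsRelPrime (X 0 : MvPolynomial (Fin 2) K) (X 0 - X 1) :=
    (h_irred 0).isRelPrime_iff_not_dvd.2 (by simp [dvd_sub_self_left, X_dvd_X])
  exact (h_one_zero.pow.mul_right h_one_diff.pow).mul_dvd h (h_zero_diff.pow.mul_dvd h_zero h_diff)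

lemma discrInvariant_mul_mem_alternatingInvariants_iff {p : MvPolynomial (Fin 2) K} :
    discrInvariant K * p ∈ alternatingInvariants K (6 + n) ↔ p ∈ alternatingInvariants K n := by
  simp only [mem_alternatingInvariants, map_mul, swapVars_discrInvariant, rotVars_discrInvariant,
    isHomogeneous_mul_iff isHomogeneous_discrInvariant discrInvariant_ne_zero, ← mul_neg,
    mul_right_inj' (discrInvariant_ne_zero (R := K))]

lemma altInvariant_mul_mem_alternatingInvariants (k : ℕ) :
    altInvariant K * quadInvariant K ^ k ∈ alternatingInvariants K (6 + 2 * k) := by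
  refine mem_alternatingInvariants.2
    ⟨isHomogeneous_altInvariant.mul (isHomogeneous_quadInvariant.pow k), ?_, ?_⟩
  · rw [map_mul, map_pow, swapVars_altInvariant, swapVars_quadInvariant, neg_mul]
  · rw [map_mul, map_pow, rotVars_altInvariant, rotVars_quadInvariant]

variable (K) in
/-- The map `(c, p) ↦ c A B ^ k + D p`, where `A`, `B` and `D` are the forms `altInvariant`,
`quadInvariant` and `discrInvariant`. -/
noncomputable def altDiscrMap (k : ℕ) :
    (K × alternatingInvariants K (2 * k)) →ₗ[K] alternatingInvariants K (6 + 2 * k) :=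
  (LinearMap.toSpanSingleton K _ ⟨_, altInvariant_mul_mem_alternatingInvariants k⟩).coprod
    ((LinearMap.mulLeft K (discrInvariant K)).restrict fun _ hp =>
      discrInvariant_mul_mem_alternatingInvariants_iff.2 hp)

lemma coe_altDiscrMap (x : K × alternatingInvariants K (2 * k)) :
    (altDiscrMap K k x).1 =
      x.1 • (altInvariant K * quadInvariant K ^ k) + discrInvariant K * x.2.1 := rfl

variable [CharZero K]

lemma discrInvariant_dvd_of_mem_alternatingInvariants {Q : MvPolynomial (Fin 2) K}
    (hQ : Q ∈ alternatingInvariants K n) (h : (dehomogenize Q).coeff 1 = 0) :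
    discrInvariant K ∣ Q := by
  obtain ⟨h_hom, h_swap, h_rot⟩ := mem_alternatingInvariants.1 hQ
  refine discrInvariant_dvd h_swap h_rot (X_pow_dvd_of_forall_mem_support fun d hd => ?_)
  by_contra! hd1
  rw [mem_support_iff, ← exponentPair_eta d] at hd
  interval_cases d 1
  · exact hd (coeff_exponentPair_zero_right_of_mem_alternatingInvariants hQ _)
  · have h_degree : d 0 + 1 = n := by
      by_contra hne
      exact hd (h_hom.coeff_eq_zero (by rwa [degree_exponentPair]))
    exact hd (by rw [← coeff_dehomogenize_of_isHomogeneous (h_degree ▸ h_hom), h])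

lemma altDiscrMap_bijective : Function.Bijective (altDiscrMap K k) := by
  constructor
  · refine (injective_iff_map_eq_zero _).2 fun x hx => ?_
    have h_sum := congrArg Subtype.val hx
    rw [coe_altDiscrMap, Submodule.coe_zero] at h_sum
    have h_fst : x.1 = 0 := by
      have h_coeff := congrArg (fun p => (dehomogenize p).coeff 1) h_sum
      simpa only [map_add, map_smul, map_zero, Polynomial.coeff_add, Polynomial.coeff_smul,
        coeff_one_dehomogenize_altInvariant_mul, coeff_one_dehomogenize_discrInvariant_mul,
        Polynomial.coeff_zero, add_zero, smul_eq_mul, mul_eq_zero, two_ne_zero, or_false]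
        using h_coeff
    rw [h_fst, zero_smul, zero_add] at h_sum
    exact Prod.ext h_fst
      (Subtype.ext ((mul_eq_zero.1 h_sum).resolve_left discrInvariant_ne_zero))
  · rintro ⟨Q, hQ⟩
    let c := (dehomogenize Q).coeff 1 / 2
    have hQ' := Submodule.sub_mem _ hQ
      (Submodule.smul_mem _ c (altInvariant_mul_mem_alternatingInvariants k))
    obtain ⟨p, hp⟩ := discrInvariant_dvd_of_mem_alternatingInvariants hQ' (by
      rw [map_sub, map_smul, Polynomial.coeff_sub, Polynomial.coeff_smul,
        coeff_one_dehomogenize_altInvariant_mul, smul_eq_mul, div_mul_cancel₀ _ two_ne_zero,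
        sub_self])
    rw [hp, discrInvariant_mul_mem_alternatingInvariants_iff] at hQ'
    refine ⟨(c, ⟨p, hQ'⟩), Subtype.ext ?_⟩
    rw [coe_altDiscrMap, ← hp, add_sub_cancel]

-- The form vanishes on the six lines `y = m x` with `m ∈ {0, 1, 2, 1/2, -1, ∞}`.
lemma alternatingInvariants_eq_bot (hk : k < 3) : alternatingInvariants K (2 * k) = ⊥ := by
  refine (Submodule.eq_bot_iff _).2 fun Q hQ => ?_
  obtain ⟨h_hom, h_swap, h_rot⟩ := mem_alternatingInvariants.1 hQ
  have h_zero : eval ![1, 0] Q = 0 := by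
    rw [eval_swap_of_swapVars_eq_neg h_swap, eval_zero_left_of_mem_alternatingInvariants hQ,
      neg_zero]
  have h_one : eval ![1, 1] Q = 0 := eval_self_self_of_swapVars_eq_neg h_swap 1
  have h_neg_one : eval ![-1, 1] Q = 0 := self_eq_neg.1 <| by
    rw [← eval_swap_of_swapVars_eq_neg h_swap, ← eval_neg_neg h_hom (even_two_mul k), neg_neg]
  have h_neg_one' : eval ![1, -1] Q = 0 := by
    rw [eval_swap_of_swapVars_eq_neg h_swap, h_neg_one, neg_zero]
  have h_two : eval ![1, 2] Q = 0 := by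
    rw [← eval_sub_left_of_rotVars_eq h_rot, show (1 : K) - 2 = -1 by norm_num, h_neg_one]
  have h_half : eval ![1, 2⁻¹] Q = 0 := self_eq_neg.1 <| by
    rw [← eval_swap_of_swapVars_eq_neg h_swap, ← eval_sub_left_of_rotVars_eq h_rot,
      show (1 : K) - 2⁻¹ = 2⁻¹ by norm_num]
  let root (i : Fin 5) : K := (![0, 1, -1, 2, 2⁻¹] i : ℚ)
  have h_root : Function.Injective root := Rat.cast_injective.comp <| by
    norm_num [Function.Injective, Fin.forall_fin_succ]
  refine eq_zero_of_dehomogenize_eq_zero h_hom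
    (Polynomial.eq_zero_of_natDegree_lt_card_of_eval_eq_zero _ h_root (fun i => ?_)
      ((natDegree_dehomogenize_le h_hom).trans_lt ?_))
  · rw [eval_dehomogenize]
    fin_cases i <;> simpa [root] using ‹_›
  · rw [Fintype.card_fin]
    omega

lemma finrank_alternatingInvariants (k : ℕ) :
    Module.finrank K (alternatingInvariants K (2 * k)) = k / 3 := by
  induction k using Nat.strong_induction_on with
  | _ k ih =>
    rcases lt_or_ge k 3 with hk | hk
    · rw [alternatingInvariants_eq_bot hk, finrank_bot, Nat.div_eq_of_lt hk]
    · obtain ⟨l, rfl⟩ := Nat.exists_eq_add_of_le hk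
      rw [show 2 * (3 + l) = 6 + 2 * l by ring,
        ← (LinearEquiv.ofBijective _ altDiscrMap_bijective).finrank_eq, Module.finrank_prod,
        Module.finrank_self, ih l (by omega), Nat.add_div_left l three_pos, add_comm]

end DimensionOfAlternatingInvariants

section DimensionOfPeriodPolynomials

lemma finrank_ker_funLeft_add_one {K ι α : Type*} [Field K] [CharZero K] [Fintype ι]
    [LinearOrder α] {σ : ι → ι} (hσ : Function.Involutive σ) {f : ι → α}
    (hf : ∀ i, f (σ i) = f i → σ i = i) :
    Module.finrank K (LinearMap.ker (LinearMap.funLeft K K σ + 1)) =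
      Fintype.card {i // f i < f (σ i)} := by
  have mem_ker (c : ι → K) :
      c ∈ LinearMap.ker (LinearMap.funLeft K K σ + 1) ↔ ∀ i, c (σ i) = -c i := by
    simp [funext_iff, LinearMap.funLeft_apply, add_eq_zero_iff_eq_neg]
  let restrict := LinearMap.funLeft K K (Subtype.val : {i // f i < f (σ i)} → ι) ∘ₗ
    (LinearMap.ker (LinearMap.funLeft K K σ + 1)).subtype
  have h_inj : Function.Injective restrict := by
    refine (injective_iff_map_eq_zero _).2 fun c hc => Subtype.ext (funext fun i => ?_)
    have h_lt {j : ι} (hj : f j < f (σ j)) : c.1 j = 0 := congrFun hc ⟨j, hj⟩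
    have h_anti := (mem_ker c.1).1 c.2 i
    rcases lt_trichotomy (f i) (f (σ i)) with hi | hi | hi
    · exact h_lt hi
    · rw [hf i hi.symm] at h_anti
      exact self_eq_neg.1 h_anti
    · exact neg_eq_zero.1 (h_anti ▸ h_lt (by rwa [hσ i]))
  have h_surj : Function.Surjective restrict := by
    intro v
    let ext (i : ι) : K := if h : f i < f (σ i) then v ⟨i, h⟩ else 0
    refine ⟨⟨fun i => ext i - ext (σ i), (mem_ker _).2 fun i => ?_⟩, funext fun i => ?_⟩
    · rw [hσ i, neg_sub]
    · have h_not : ¬f (σ i) < f (σ (σ i)) := by rw [hσ i]; exact i.2.not_gt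
      change ext i - ext (σ i) = v i
      simp only [ext, dif_pos i.2, dif_neg h_not, sub_zero]
  rw [(LinearEquiv.ofBijective restrict ⟨h_inj, h_surj⟩).finrank_eq,
    Module.finrank_fintype_fun_eq_card]

variable {N : ℕ}

lemma card_oddIdx_two_lt (hN : Even N) :
    Fintype.card {m : OddIdx N 2 // m.1 0 < m.1 1} = N / 4 - 1 := by
  have h_bounds (m : OddIdx N 2) : m.1 0 + m.1 1 = N ∧ 3 ≤ m.1 0 ∧ m.1 0 % 2 = 1 := by
    obtain ⟨h_sum, h_odd⟩ := mem_oddIndices.1 m.2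
    exact ⟨(Fin.sum_univ_two _).symm.trans h_sum, (h_odd 0).1, Nat.odd_iff.1 (h_odd 0).2⟩
  have h_mem (i : Fin (N / 4 - 1)) : ![2 * i.1 + 3, N - (2 * i.1 + 3)] ∈ oddIndices N 2 := by
    rw [Nat.even_iff] at hN
    simp only [mem_oddIndices, Fin.sum_univ_two, Fin.forall_fin_two, Matrix.cons_val_zero,
      Matrix.cons_val_one, Nat.odd_iff]
    omega
  rw [← Fintype.card_fin (N / 4 - 1)]
  refine Fintype.card_congr
    { toFun := fun m => ⟨(m.1.1 0 - 3) / 2, ?_⟩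
      invFun := fun i => ⟨⟨_, h_mem i⟩, ?_⟩
      left_inv := fun m => Subtype.ext (Subtype.ext (funext (Fin.forall_fin_two.2 ?_)))
      right_inv := fun i => Fin.ext ?_ }
  · have h := h_bounds m.1
    have h_lt := m.2
    rw [Nat.even_iff] at hN
    omega
  · change 2 * i.1 + 3 < N - (2 * i.1 + 3)
    omega
  · change 2 * ((m.1.1 0 - 3) / 2) + 3 = m.1.1 0 ∧ N - (2 * ((m.1.1 0 - 3) / 2) + 3) = m.1.1 1
    have h := h_bounds m.1
    omega
  · change (2 * i.1 + 3 - 3) / 2 = i.1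
    omega

lemma finrank_antisymmPolys (hN : Even N) : Module.finrank ℚ (antisymmPolys N) = N / 4 - 1 := by
  let e := (evenMonomials N 2).equivFun
  have h_map : (antisymmPolys N).map e.toLinearMap =
      LinearMap.ker (LinearMap.funLeft ℚ ℚ OddIdx.reverse + 1) := by
    ext c
    have coeff_symm (m : OddIdx N 2) :
        MvPolynomial.coeff (shiftedExponent m.1) (e.symm c).1 = c m := by
      rw [← evenMonomials_equivFun_apply]
      exact congrFun (e.apply_symm_apply c) m
    simp_rw [Submodule.mem_map_equiv, mem_antisymmPolys_iff_forall_coeff, coeff_symm]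
    simp [funext_iff, LinearMap.funLeft_apply, add_eq_zero_iff_eq_neg]
  have h_fixed (m : OddIdx N 2) (hm : m.reverse.1 0 = m.1 0) : m.reverse = m :=
    Subtype.ext <| funext <| Fin.forall_fin_two.2 ⟨hm, hm.symm⟩
  rw [(e.submoduleMap _).finrank_eq, h_map,
    finrank_ker_funLeft_add_one (f := fun m : OddIdx N 2 => m.1 0) reverse_reverse h_fixed]
  exact card_oddIdx_two_lt hN

lemma finrank_periodPolys_two_add (hN : Even N) (hN2 : 2 ≤ N) :
    Module.finrank ℚ (periodPolys N 2) + (N - 2) / 6 = N / 4 - 1 := by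
  have h_map : (antisymmPolys N).map (rotSum ∘ₗ (evenPolys N 2).subtype) =
      alternatingInvariants ℚ (N - 2) := by
    refine le_antisymm ?_ fun Q hQ => exists_rotSum_eq_of_mem_alternatingInvariants hN hN2 hQ
    rintro _ ⟨P, hP, rfl⟩
    exact rotSum_mem_alternatingInvariants_of_mem_antisymmPolys hN hP
  have h_ker : LinearMap.ker (rotSum ∘ₗ (evenPolys N 2).subtype) ⊓ antisymmPolys N =
      periodPolys N 2 := by
    ext P
    rw [mem_periodPolys_two_iff hN, Submodule.mem_inf, and_comm]
    rfl
  obtain ⟨k, hk⟩ := even_iff_two_dvd.1 (hN.tsub even_two)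
  have h_rank :=
    finrank_map_add_finrank_ker_inf (rotSum ∘ₗ (evenPolys N 2).subtype) (antisymmPolys N)
  rw [h_map, h_ker, hk, finrank_alternatingInvariants, finrank_antisymmPolys hN] at h_rank
  omega

lemma finrank_periodPolys_two_eq_zero (hN : ¬(Even N ∧ 4 ≤ N)) :
    Module.finrank ℚ (periodPolys N 2) = 0 := by
  have : IsEmpty (OddIdx N 2) := ⟨fun m => hN (even_and_four_le m)⟩
  have : Subsingleton (evenPolys N 2) := (evenMonomials N 2).equivFun.injective.subsingleton
  exact Module.finrank_zero_of_subsingleton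

end DimensionOfPeriodPolynomials

section GeneratingSeries

open PowerSeries Finset.HasAntidiagonal

lemma mul_one_sub_C_mul_X_add_C_mul_X_sq_eq_one {R : Type*} [CommRing R] {F : R⟦X⟧} {a b : R}
    (h_zero : coeff 0 F = 1) (h_one : coeff 1 F = a)
    (h_rec : ∀ r, coeff (r + 2) F + b * coeff r F = a * coeff (r + 1) F) :
    F * (1 - C a * X + C b * X ^ 2) = 1 := by
  have h_expand : F * (1 - C a * X + C b * X ^ 2) = F - C a * (F * X) + C b * (F * X ^ 2) := by
    ring
  rw [h_expand]
  ext r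
  rw [map_add, map_sub, coeff_C_mul, coeff_C_mul, coeff_one]
  rcases r with _ | _ | r
  · simp [coeff_mul_X_pow', h_zero]
  · simp [coeff_mul_X_pow', coeff_succ_mul_X, h_one, h_zero]
  · rw [coeff_succ_mul_X, coeff_mul_X_pow F 2 r, if_neg (by omega)]
    linear_combination h_rec r

lemma card_oddIdx_one (N : ℕ) :
    Fintype.card (OddIdx N 1) = if Odd N ∧ 3 ≤ N then 1 else 0 := by
  split_ifs with hN
  · refine Fintype.card_eq_one_iff.2
      ⟨⟨fun _ => N, mem_oddIndices.2 ⟨by simp, fun _ => hN.symm⟩⟩, fun m => ?_⟩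
    refine Subtype.ext (funext (Fin.forall_fin_one.2 ?_))
    exact (Fin.sum_univ_one _).symm.trans (mem_oddIndices.1 m.2).1
  · refine Fintype.card_eq_zero_iff.2 ⟨fun m => hN ?_⟩
    obtain ⟨h_sum, h_odd⟩ := mem_oddIndices.1 m.2
    rw [← h_sum, Fin.sum_univ_one]
    exact (h_odd 0).symm

lemma seriesO_eq_mk : seriesO = mk fun N => (Fintype.card (OddIdx N 1) : ℚ) := by
  have h_unit : constantCoeff (1 - X ^ 2 : ℚ⟦X⟧) ≠ 0 := by simp
  rw [seriesO, eq_comm, eq_mul_inv_iff_mul_eq h_unit, mul_sub, mul_one]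
  ext N
  simp only [map_sub, coeff_mul_X_pow', coeff_mk, coeff_X_pow, card_oddIdx_one, Nat.odd_iff]
  have h_int : ((if N % 2 = 1 ∧ 3 ≤ N then 1 else 0 : ℕ) : ℤ) -
      (if 2 ≤ N then ((if (N - 2) % 2 = 1 ∧ 3 ≤ N - 2 then 1 else 0 : ℕ) : ℤ) else 0) =
      if N = 3 then 1 else 0 := by
    split_ifs <;> omega
  exact_mod_cast congrArg (Int.cast : ℤ → ℚ) h_int

lemma finrank_periodPolys_two_recursion (N : ℕ) :
    (Module.finrank ℚ (periodPolys N 2) : ℤ) -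
      (if 4 ≤ N then (Module.finrank ℚ (periodPolys (N - 4) 2) : ℤ) else 0) -
      (if 6 ≤ N then (Module.finrank ℚ (periodPolys (N - 6) 2) : ℤ) else 0) +
      (if 10 ≤ N then (Module.finrank ℚ (periodPolys (N - 10) 2) : ℤ) else 0) =
      if N = 12 then 1 else 0 := by
  have h_cases (M : ℕ) : (M % 2 = 0 ∧ 4 ≤ M ∧
      Module.finrank ℚ (periodPolys M 2) + (M - 2) / 6 = M / 4 - 1) ∨
      (¬(M % 2 = 0 ∧ 4 ≤ M) ∧ Module.finrank ℚ (periodPolys M 2) = 0) := by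
    rw [← Nat.even_iff]
    by_cases hM : Even M ∧ 4 ≤ M
    · exact Or.inl ⟨hM.1, hM.2, finrank_periodPolys_two_add hM.1 (by omega)⟩
    · exact Or.inr ⟨hM, finrank_periodPolys_two_eq_zero hM⟩
  have h₀ := h_cases N
  have h₄ := h_cases (N - 4)
  have h₆ := h_cases (N - 6)
  have h₁₀ := h_cases (N - 10)
  generalize Module.finrank ℚ (periodPolys N 2) = w₀ at *
  generalize Module.finrank ℚ (periodPolys (N - 4) 2) = w₄ at *
  generalize Module.finrank ℚ (periodPolys (N - 6) 2) = w₆ at *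
  generalize Module.finrank ℚ (periodPolys (N - 10) 2) = w₁₀ at *
  clear h_cases
  rcases Nat.even_or_odd' N with ⟨M, rfl | rfl⟩ <;> split_ifs <;> omega

lemma seriesS_eq_mk : seriesS = mk fun N => (Module.finrank ℚ (periodPolys N 2) : ℚ) := by
  have h_unit : constantCoeff ((1 - X ^ 4) * (1 - X ^ 6) : ℚ⟦X⟧) ≠ 0 := by simp
  have h_expand (A : ℚ⟦X⟧) : A * ((1 - X ^ 4) * (1 - X ^ 6)) =
      A - A * X ^ 4 - A * X ^ 6 + A * X ^ 10 := by
    ring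
  rw [seriesS, eq_comm, eq_mul_inv_iff_mul_eq h_unit, h_expand]
  ext N
  simp only [map_add, map_sub, coeff_mul_X_pow', coeff_mk, coeff_X_pow]
  exact_mod_cast congrArg (Int.cast : ℤ → ℚ) (finrank_periodPolys_two_recursion N)

/-- The rank of `C_{N,r}`, with the convention that `C_{N,0}` has rank `1` for `N = 0` and rank
`0` otherwise, so that it is the coefficient of `x^N y^r` in the rank series for all `N` and `r`. -/
noncomputable def rankCoeff (N r : ℕ) : ℕ :=
  if r = 0 then (if N = 0 then 1 else 0) else (matC N r).rank

lemma rankCoeff_zero_right (N : ℕ) : rankCoeff N 0 = if N = 0 then 1 else 0 := if_pos rfl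

lemma rankCoeff_of_pos {r : ℕ} (hr : 0 < r) (N : ℕ) : rankCoeff N r = (matC N r).rank :=
  if_neg hr.ne'

lemma rankCoeff_zero_left {r : ℕ} (hr : 0 < r) : rankCoeff 0 r = 0 := by
  have : IsEmpty (OddIdx 0 r) := ⟨fun m => by
    obtain ⟨h_sum, h_odd⟩ := mem_oddIndices.1 m.2
    have h_three := (h_odd ⟨0, hr⟩).1
    rw [Finset.sum_eq_zero_iff.1 h_sum _ (Finset.mem_univ _)] at h_three
    omega⟩
  rw [rankCoeff_of_pos hr]
  exact Nat.le_zero.1 ((matC 0 r).rank_le_card_width.trans_eq Fintype.card_eq_zero)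

lemma rankCoeff_one (N : ℕ) : rankCoeff N 1 = Fintype.card (OddIdx N 1) := by
  rw [rankCoeff_of_pos one_pos, rank_matC_eq_finrank_range_phiComp le_rfl, phiComp_one,
    LinearMap.range_id, finrank_top, Module.finrank_eq_card_basis (evenMonomials N 1)]

lemma coeff_coeff_rankSeries (N r : ℕ) :
    coeff N (coeff r rankSeries) = (rankCoeff N r : ℚ) := by
  rw [rankSeries, map_add, map_add, coeff_mk, coeff_mk, coeff_one]
  rcases r.eq_zero_or_pos with rfl | hr
  · simp [rankCoeff_zero_right, coeff_one]
  rw [if_neg hr.ne', map_zero, zero_add]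
  rcases N.eq_zero_or_pos with rfl | hN
  · simp [rankCoeff_zero_left hr]
  · rw [if_pos ⟨hN, hr⟩, rankCoeff_of_pos hr]

lemma ker_phi_inf_range_phiComp (h_im : ImageKernelConjecture) {N : ℕ} (hN : 0 < N) (l : ℕ) :
    LinearMap.ker (phi N (l + 2) (l + 2)) ⊓ LinearMap.range (phiComp N (l + 2) (l + 1)) =
      (periodPolys N (l + 2)).map (phiComp N (l + 2) (l + 1)) := by
  rcases l with _ | l
  · rw [phiComp_one, Submodule.map_id, LinearMap.range_id, inf_top_eq, ker_phi_two]
  · exact (h_im (l + 3) N (by omega) hN).symm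

lemma finrank_map_phiComp_periodPolys_eq_sum_rankCoeff (h_inj : TasakaInjectivity) {N : ℕ}
    (hN : 0 < N) (l : ℕ) :
    Module.finrank ℚ ((periodPolys N (l + 2)).map (phiComp N (l + 2) (l + 1))) =
      ∑ p ∈ antidiagonal N, Module.finrank ℚ (periodPolys p.1 2) * rankCoeff p.2 l := by
  rcases l.eq_zero_or_pos with rfl | hl
  · rw [phiComp_one, Submodule.map_id, Finset.Nat.sum_antidiagonal_eq_sum_range_succ_mk,
      Finset.sum_range_succ, Finset.sum_eq_zero]
    · simp [rankCoeff_zero_right]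
    · intro n hn
      rw [rankCoeff_zero_right, if_neg (by have := Finset.mem_range.1 hn; omega), mul_zero]
  · have h_le : (periodPolys N (l + 2)).map (phiComp N (l + 2) l) ≤ periodPolys N (l + 2) := by
      rw [add_comm l 2]
      exact Submodule.map_le_iff_le_comap.2 fun P hP => phiComp_mem_periodPolys hl hP
    rw [phiComp_succ hl, Submodule.map_comp,
      finrank_map_phi_of_le_periodPolys (h_inj (l + 2) N (by omega) hN) h_le, add_comm l 2,
      finrank_map_phiComp_periodPolys hl]
    simp only [rankCoeff_of_pos hl]

lemma rankCoeff_recursion (h_inj : TasakaInjectivity) (h_im : ImageKernelConjecture) (N l : ℕ) :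
    rankCoeff N (l + 2) +
        ∑ p ∈ antidiagonal N, Module.finrank ℚ (periodPolys p.1 2) * rankCoeff p.2 l =
      ∑ p ∈ antidiagonal N, Fintype.card (OddIdx p.1 1) * rankCoeff p.2 (l + 1) := by
  rcases N.eq_zero_or_pos with rfl | hN
  · simp [rankCoeff_zero_left, finrank_periodPolys_two_eq_zero (N := 0) (by omega)]
  have h_rank := finrank_map_add_finrank_ker_inf (phi N (l + 2) (l + 2))
    (LinearMap.range (phiComp N (l + 2) (l + 1)))
  have h_total := finrank_range_phiComp (N := N) (k := 1) (Nat.succ_pos l)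
  rw [show 1 + (l + 1) = l + 2 by omega] at h_total
  rw [ker_phi_inf_range_phiComp h_im hN,
    finrank_map_phiComp_periodPolys_eq_sum_rankCoeff h_inj hN, ← LinearMap.range_comp,
    ← phiComp_succ (Nat.succ_pos l), ← rank_matC_eq_finrank_range_phiComp (by omega),
    h_total] at h_rank
  simpa only [rankCoeff_of_pos (Nat.succ_pos _)] using h_rank

lemma coeff_mk_mul_coeff_rankSeries (w : ℕ → ℕ) (N r : ℕ) :
    coeff N (mk (fun n => (w n : ℚ)) * coeff r rankSeries) =
      ((∑ p ∈ antidiagonal N, w p.1 * rankCoeff p.2 r : ℕ) : ℚ) := by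
  simp only [coeff_mul, coeff_mk, coeff_coeff_rankSeries]
  push_cast
  rfl

lemma coeff_zero_rankSeries : coeff 0 rankSeries = 1 := by
  ext N
  rw [coeff_coeff_rankSeries, rankCoeff_zero_right, coeff_one, Nat.cast_ite, Nat.cast_one,
    Nat.cast_zero]

lemma coeff_one_rankSeries : coeff 1 rankSeries = seriesO := by
  ext N
  rw [coeff_coeff_rankSeries, rankCoeff_one, seriesO_eq_mk, coeff_mk]

lemma coeff_rankSeries_recursion (h_inj : TasakaInjectivity) (h_im : ImageKernelConjecture)
    (r : ℕ) :
    coeff (r + 2) rankSeries + seriesS * coeff r rankSeries =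
      seriesO * coeff (r + 1) rankSeries := by
  ext N
  rw [seriesO_eq_mk, seriesS_eq_mk, map_add, coeff_mk_mul_coeff_rankSeries,
    coeff_mk_mul_coeff_rankSeries, coeff_coeff_rankSeries, ← rankCoeff_recursion h_inj h_im,
    Nat.cast_add]

end GeneratingSeries

theorem mainTheorem5 (h_inj : TasakaInjectivity) (h_im : ImageKernelConjecture) :
    rankSeries =
      PowerSeries.invOfUnit
        (1 - PowerSeries.C seriesO * PowerSeries.X + PowerSeries.C seriesS * PowerSeries.X ^ 2)
        1 := by
  set D : PowerSeries (PowerSeries ℚ) :=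
    1 - PowerSeries.C seriesO * PowerSeries.X + PowerSeries.C seriesS * PowerSeries.X ^ 2 with hD
  have h_mul : rankSeries * D = 1 := mul_one_sub_C_mul_X_add_C_mul_X_sq_eq_one
    coeff_zero_rankSeries coeff_one_rankSeries (coeff_rankSeries_recursion h_inj h_im)
  have h_inv : D * PowerSeries.invOfUnit D 1 = 1 := PowerSeries.mul_invOfUnit D 1 (by simp [hD])
  exact left_inv_eq_right_inv h_mul h_inv
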